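/- Fix $L>0$, $\omega_0>0$, $\alpha\ge 0$, $v\in\mathbb R$ and $f\in C^2(\mathbb R)$, and put $\omega_1=\omega_0L$. Let $X,V\in C^4(\mathbb R)$ be $L$-periodic with $X>0$, $\int_0^LX(u)\,du=L$, $\int_0^LV(u)\,du=0$. For every sufficiently large $N$ let $x^{(N)}_k(t)$, $k\in\mathbb Z$, $t\ge0$, satisfy $x^{(N)}_{k+N}=x^{(N)}_k+L$ and $$\ddot x^{(N)}_k=(\omega_0N)^2\bigl(x^{(N)}_{k+1}-2x^{(N)}_k+x^{(N)}_{k-1}\bigr)-\alpha\dot x^{(N)}_k+f(t),$$ with initial data such that $x^{(N)}_0(0)=0$, $\dot x^{(N)}_0(0)=v$, $x^{(N)}_k(0)<x^{(N)}_{k+1}(0)$ and, for constants $C_1,C_2>0$ and all $k$ and all large $N$, $$\Bigl|x^{(N)}_{k+1}(0)-x^{(N)}_k(0)-\tfrac LNX\bigl(\tfrac{kL}N\bigr)\Bigr|<\frac{C_1}{N^2},\qquad \Bigl|\dot x^{(N)}_{k+1}(0)-\dot x^{(N)}_k(0)-\tfrac LNV\bigl(\tfrac{kL}N\bigr)\Bigr|<\frac{C_2}{N^2}.$$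 Let $c_1=L\int_0^L|X''(u)|\,du$, $c_2=L\int_0^L|V''(u)|\,du$ and suppose that, for some $0<\delta<1$, $$\gamma=\Bigl(1+\frac{\alpha}{8\omega_0}\Bigr)(2c_1+C_1L^{-1})+\frac{2c_2+C_2L^{-1}}{4\omega_0}<\delta .$$ For $a\in\mathbb R$ let $k(a,N)$ be the index with $x^{(N)}_{k(a,N)}(0)\le a<x^{(N)}_{k(a,N)+1}(0)$. Then the limits $$Y(t,a)=\lim_{N\to\infty}x^{(N)}_{k(a,N)}(t)\quad(t\ge0,\ a\in\mathbb R),$$ $$F(t,y)=\lim_{N\to\infty}\frac1N\#\bigl\{k\in\{0,\dots,N-1\}: x^{(N)}_k(t)\bmod L\le y\bigr\}\quad(t\ge0,\ y\in[0,L))$$ exist, $F$ is differentiable in $y\in[0,L)$ (one-sidedly at $y=0$) with density $\rho=\partial F/\partial y>0$, and $Y(t,a)$ is differentiable in $t>0$. Put $$G(t,z)=Y\Bigl(t,\int_0^zX(u)\,du\Bigr),\qquad \hat\rho(t,z)=L\,\rho\bigl(t,G(t,z)\bmod L\bigr),\qquad \hat u(t,z)=\frac{\partial G(t,z)}{\partial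 t},$$ and, for an arbitrary constant $C$, $\hat p(t,z)=-\dfrac{\omega_1^2}{\hat\rho(t,z)}+C$. Then for all $t>0$ and $z\in[0,L)$ the following derivatives exist and $$\frac{\partial}{\partial t}\Bigl(\frac1{\hat\rho(t,z)}\Bigr)-\frac{\partial\hat u(t,z)}{\partial z}=0,$$ $$\frac{\partial\hat u(t,z)}{\partial t}+\alpha\hat u(t,z)-f(t)=-\frac{\partial\hat p(t,z)}{\partial z}=\frac{\partial}{\partial z}\Bigl(\frac{\omega_1^2}{\hat\rho(t,z)}\Bigr).$$ -/

import Mathlib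

open Filter Topology Set

noncomputable section

namespace StringFlow

/-- A periodic chain of `N` particles per period `L` on the line, moving for `t ≥ 0` according to
`x_k'' = ω² (x_{k+1} - 2 x_k + x_{k-1}) - α x_k' + f(t)`.  Here `v k` is the velocity of
particle `k`; at `t = 0` the derivatives are one-sided. -/
structure IsChainTrajectory (L ω α : ℝ) (f : ℝ → ℝ) (N : ℕ) (x v : ℤ → ℝ → ℝ) : Prop where
  periodic : ∀ k : ℤ, ∀ t : ℝ, 0 ≤ t → x (k + N) t = x k t + L
  hasDeriv_pos : ∀ k : ℤ, ∀ t : ℝ, 0 ≤ t → HasDerivWithinAt (x k) (v k t) (Ici 0) t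
  hasDeriv_vel : ∀ k : ℤ, ∀ t : ℝ, 0 ≤ t →
    HasDerivWithinAt (v k)
      (ω ^ 2 * (x (k + 1) t - 2 * x k t + x (k - 1) t) - α * v k t + f t) (Ici 0) t

/-- Profiles of the initial gaps (`X`) and of the initial velocity differences (`V`). -/
structure IsProfile (L : ℝ) (X V : ℝ → ℝ) : Prop where
  contDiff_X : ContDiff ℝ 4 X
  contDiff_V : ContDiff ℝ 4 V
  periodic_X : Function.Periodic X L
  periodic_V : Function.Periodic V L
  pos_X : ∀ u, 0 < X u
  integral_X : ∫ u in (0 : ℝ)..L, X u = L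
  integral_V : ∫ u in (0 : ℝ)..L, V u = 0

/-- The initial positions `p k = x_k(0)` and velocities `w k = x_k'(0)` are ordered, with
`x_0(0) = 0`, and are almost smooth with profiles `X`, `V` and constants `C₁`, `C₂`. -/
structure IsAlmostSmooth (L : ℝ) (X V : ℝ → ℝ) (C₁ C₂ : ℝ) (N : ℕ) (p w : ℤ → ℝ) : Prop where
  zero : p 0 = 0
  ordered : ∀ k : ℤ, p k < p (k + 1)
  gap : ∀ k : ℤ, |p (k + 1) - p k - L / N * X (k * L / N)| < C₁ / (N : ℝ) ^ 2
  vel : ∀ k : ℤ, |w (k + 1) - w k - L / N * V (k * L / N)| < C₂ / (N : ℝ) ^ 2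

/-- `L ∫₀ᴸ |g''(u)| du`, the constant `c₁` for `g = X` and `c₂` for `g = V`. -/
def fluct (L : ℝ) (g : ℝ → ℝ) : ℝ := L * ∫ u in (0 : ℝ)..L, |iteratedDeriv 2 g u|

/-- The constant `γ`. -/
def gammaConst (L ω₀ α : ℝ) (X V : ℝ → ℝ) (C₁ C₂ : ℝ) : ℝ :=
  (1 + α / (8 * ω₀)) * (2 * fluct L X + C₁ * L⁻¹)
    + (2 * fluct L V + C₂ * L⁻¹) / (4 * ω₀)

/-- The number `k` of the particle with `p k ≤ a < p (k + 1)` (it is unique if `p` is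
increasing and unbounded in both directions). -/
def particleIndex (p : ℤ → ℝ) (a : ℝ) : ℤ :=
  Classical.epsilon fun k : ℤ => p k ≤ a ∧ a < p (k + 1)

/-- Position at time `t` of the particle of the `N`-th system that is associated with the
initial point `a`. -/
def tracer (x : ℕ → ℤ → ℝ → ℝ) (N : ℕ) (t a : ℝ) : ℝ :=
  x N (particleIndex (fun k => x N k 0) a) t

/-- Trajectory `Y(t,a)` of the continuum particle that starts at `a`. -/
def Y (x : ℕ → ℤ → ℝ → ℝ) (t a : ℝ) : ℝ := limUnder atTop fun N : ℕ => tracer x N t a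

/-- `x(z) = ∫₀ᶻ X`, the inverse of the function `z(x)` given by `∫₀^{z(x)} X = x`. -/
def xOfZ (X : ℝ → ℝ) (z : ℝ) : ℝ := ∫ u in (0 : ℝ)..z, X u

/-- The motion in Lagrangian coordinates, `G(t,z) = Y(t,x(z))`. -/
def G (X : ℝ → ℝ) (x : ℕ → ℤ → ℝ → ℝ) (t z : ℝ) : ℝ := Y x t (xOfZ X z)

/-- Empirical distribution function on the circle `[0,L)`: the proportion of the particles
`0, …, N-1` with `x_k(t) mod L ≤ y`. -/
def empiricalF {L : ℝ} (hL : 0 < L) (x : ℕ → ℤ → ℝ → ℝ) (N : ℕ) (t y : ℝ) : ℝ :=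
  (((Finset.range N).filter fun k : ℕ => toIcoMod hL 0 (x N (k : ℤ) t) ≤ y).card : ℝ) / N

/-- The limiting distribution function `F(t,y)`, `y ∈ [0,L)`. -/
def F {L : ℝ} (hL : 0 < L) (x : ℕ → ℤ → ℝ → ℝ) (t y : ℝ) : ℝ :=
  limUnder atTop fun N : ℕ => empiricalF hL x N t y

/-- The density `ρ(t,y) = dF/dy` on `[0,L)` (one-sided at `y = 0`). -/
def rho {L : ℝ} (hL : 0 < L) (x : ℕ → ℤ → ℝ → ℝ) (t y : ℝ) : ℝ :=
  derivWithin (F hL x t) (Ico 0 L) y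

/-- The density in Lagrangian coordinates, `L ρ(t, G(t,z))`, where the point `G(t,z)` is taken
modulo `L` on the circle `[0,L)`. -/
def rhoHat {L : ℝ} (hL : 0 < L) (X : ℝ → ℝ) (x : ℕ → ℤ → ℝ → ℝ) (t z : ℝ) : ℝ :=
  L * rho hL x t (toIcoMod hL 0 (G X x t z))

/-- The velocity in Lagrangian coordinates, `∂G/∂t`. -/
def uHat (X : ℝ → ℝ) (x : ℕ → ℤ → ℝ → ℝ) (t z : ℝ) : ℝ := deriv (fun s => G X x s z) t

/-- The pressure in Lagrangian coordinates, `-ω₁² / ρ̂ + C`. -/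
def pHat {L : ℝ} (hL : 0 < L) (ω₁ C : ℝ) (X : ℝ → ℝ) (x : ℕ → ℤ → ℝ → ℝ) (t z : ℝ) : ℝ :=
  -ω₁ ^ 2 / rhoHat hL X x t z + C

end StringFlow

end

/-! The chain is the discretisation, with step L/N and labels z = kL/N, of the damped string g_tt +
α g_t = ω₁² g_zz + f with g(0,z) = ∫₀ᶻ X and g_t(0,z) = v + ∫₀ᶻ V. Every quantity in the theorem can
be read off from g. If Z(t,·) is the inverse of g(t,·), then G = g and F(t,y) = (Z(t,y) - Z(t,0))/L,
hence ρ̂ = 1/g_z and û = g_t. The first equation then says g_zt = g_tz, and the second is the string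
equation.

Existence of g (`exists_isStringMotion`): g is z plus a mean motion plus a Fourier series whose
modes are damped oscillators. Conservation of energy up to damping bounds the modes by the
coefficients of the initial data. As X and V are C⁴, their primitives have coefficients of order
|n|⁻⁵, enough for all derivatives in the equation and for g_zz to be Lipschitz in z.

Monotonicity (`exists_profile_motion`): the same mode bounds give |g_z - 1| ≤ const < 1 for t ≥ 0 as
soon as γ < 1. So g(t,·) is the lift of a circle diffeomorphism, with g_z ≥ m > 0 uniformly in t.

Convergence (`exists_chain_dist_le`): the error x_k(t) - g(t,kL/N) solves the chain equation with a
forcing of order 1/N. Its energy, summed over a period, stays of order 1/N (`chain_energy_le`), so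
each particle is within O(N^{-1/2}) of the string, uniformly in k for fixed t.

Uniform closeness to a monotone lift then yields the limits of the tracers and of the empirical
distribution by counting labels (`tracer_tendsto`, `empirical_tendsto`). -/

namespace StringFlow

/-! ### Energy of the damped oscillator -/

/-- The damped oscillator `c'' = -α c' - ω² c` has a global solution for all initial data. -/
theorem exists_damped_oscillation (α ω : ℝ) (a b : ℂ) :
    ∃ c c' : ℝ → ℂ, c 0 = a ∧ c' 0 = b ∧ (∀ t, HasDerivAt c (c' t) t) ∧
      ∀ t, HasDerivAt c' (-(α * c' t) - ω ^ 2 * c t) t := by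
  -- The generator of the first-order system for the pair (c, c'); its exponential is the flow.
  let A : ℂ × ℂ →L[ℝ] ℂ × ℂ := (ContinuousLinearMap.snd ℝ ℂ ℂ).prod
    (-(α • ContinuousLinearMap.snd ℝ ℂ ℂ) - (ω ^ 2) • ContinuousLinearMap.fst ℝ ℂ ℂ)
  have key : ∀ t : ℝ, HasDerivAt (fun t : ℝ => NormedSpace.exp (t • A) (a, b))
      (A (NormedSpace.exp (t • A) (a, b))) t := by
    intro t
    have h := (hasDerivAt_exp_smul_const' A t).clm_apply (hasDerivAt_const t (a, b))
    simpa using h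
  have h0 : NormedSpace.exp ((0 : ℝ) • A) (a, b) = (a, b) := by
    have : NormedSpace.exp ((0 : ℝ) • A) = 1 := by
      rw [show (0 : ℝ) • A = 0 from zero_smul ℝ A]
      exact NormedSpace.exp_zero
    rw [this]
    rfl
  refine ⟨fun t => (NormedSpace.exp (t • A) (a, b)).1, fun t => (NormedSpace.exp (t • A) (a, b)).2,
    congrArg Prod.fst h0, congrArg Prod.snd h0,
    fun t => (ContinuousLinearMap.fst ℝ ℂ ℂ).hasFDerivAt.comp_hasDerivAt t (key t), fun t => ?_⟩
  refine HasDerivAt.congr_deriv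
    ((ContinuousLinearMap.snd ℝ ℂ ℂ).hasFDerivAt.comp_hasDerivAt t (key t)) ?_
  simp [A]

section Energy

variable {α ω : ℝ} {c c' : ℝ → ℂ}

/-- The restoring force contributes -2ω²⟨c, c'⟩, which cancels the derivative of ω²‖c‖²; only the
damping remains. -/
theorem hasDerivAt_oscillation_energy (h₁ : ∀ t, HasDerivAt c (c' t) t)
    (h₂ : ∀ t, HasDerivAt c' (-(α * c' t) - ω ^ 2 * c t) t) (t : ℝ) :
    HasDerivAt (fun t => ‖c' t‖ ^ 2 + ω ^ 2 * ‖c t‖ ^ 2) (-(2 * α * ‖c' t‖ ^ 2)) t := by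
  have h := (h₂ t).norm_sq.add ((h₁ t).norm_sq.const_mul (ω ^ 2))
  refine h.congr_deriv ?_
  rw [← Complex.normSq_eq_norm_sq, Complex.normSq_apply, ← Complex.ofReal_pow]
  generalize ω ^ 2 = q
  simp [Complex.inner]
  ring

theorem oscillation_energy_le (hα : 0 ≤ α) (h₁ : ∀ t, HasDerivAt c (c' t) t)
    (h₂ : ∀ t, HasDerivAt c' (-(α * c' t) - ω ^ 2 * c t) t) {t : ℝ} (ht : 0 ≤ t) :
    ‖c' t‖ ^ 2 + ω ^ 2 * ‖c t‖ ^ 2 ≤ ‖c' 0‖ ^ 2 + ω ^ 2 * ‖c 0‖ ^ 2 := by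
  have hd := hasDerivAt_oscillation_energy h₁ h₂
  have : Antitone (fun t => ‖c' t‖ ^ 2 + ω ^ 2 * ‖c t‖ ^ 2) :=
    antitone_of_deriv_nonpos (fun t => (hd t).differentiableAt) fun t => by
      rw [(hd t).deriv]
      have : 0 ≤ 2 * α * ‖c' t‖ ^ 2 := by positivity
      linarith
  exact this ht

/-- Backwards in time the energy grows at rate at most 2α, since exp(2αt) times the energy is
monotone. Times slightly below 0 are admitted so that the string has two-sided time derivatives at t
= 0. -/
theorem oscillation_energy_le_exp (hα : 0 ≤ α) (h₁ : ∀ t, HasDerivAt c (c' t) t)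
    (h₂ : ∀ t, HasDerivAt c' (-(α * c' t) - ω ^ 2 * c t) t) {t : ℝ} (ht : -1 < t) :
    ‖c' t‖ ^ 2 + ω ^ 2 * ‖c t‖ ^ 2 ≤
      Real.exp (2 * α) * (‖c' 0‖ ^ 2 + ω ^ 2 * ‖c 0‖ ^ 2) := by
  have h0 : 0 ≤ ‖c' 0‖ ^ 2 + ω ^ 2 * ‖c 0‖ ^ 2 := by positivity
  rcases le_total 0 t with h | h
  · exact (oscillation_energy_le hα h₁ h₂ h).trans
      (le_mul_of_one_le_left h0 (Real.one_le_exp (by positivity)))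
  have hd : ∀ t, HasDerivAt
      (fun t => Real.exp (2 * α * t) * (‖c' t‖ ^ 2 + ω ^ 2 * ‖c t‖ ^ 2))
      (Real.exp (2 * α * t) * (2 * α * (ω ^ 2 * ‖c t‖ ^ 2))) t := by
    intro t
    have h := (((hasDerivAt_id t).const_mul (2 * α)).exp).mul
      (hasDerivAt_oscillation_energy h₁ h₂ t)
    refine h.congr_deriv ?_
    simp only [id]
    ring
  have hm : Monotone (fun t => Real.exp (2 * α * t) * (‖c' t‖ ^ 2 + ω ^ 2 * ‖c t‖ ^ 2)) :=
    monotone_of_deriv_nonneg (fun t => (hd t).differentiableAt) fun t => by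
      rw [(hd t).deriv]; positivity
  have := hm h
  simp only [mul_zero, Real.exp_zero, one_mul] at this
  refine le_trans ?_ (mul_le_mul_of_nonneg_left this (Real.exp_pos _).le)
  rw [← mul_assoc, ← Real.exp_add]
  refine le_mul_of_one_le_left (by positivity) (Real.one_le_exp ?_)
  nlinarith

/-- Bounds on an oscillation from a bound on its energy. -/
theorem oscillation_bounds_of_energy {K a b : ℝ} (hω : 0 < ω) (hK : 0 ≤ K) (ha : 0 ≤ a)
    (hb : 0 ≤ b) {y y' : ℂ} (h : ‖y'‖ ^ 2 + ω ^ 2 * ‖y‖ ^ 2 ≤ K ^ 2 * (b ^ 2 + ω ^ 2 * a ^ 2)) :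
    ‖y'‖ ≤ K * (ω * a + b) ∧ ‖y‖ ≤ K * (a + b / ω) := by
  have h0 : K ^ 2 * (b ^ 2 + ω ^ 2 * a ^ 2) ≤ (K * (ω * a + b)) ^ 2 := by
    rw [mul_pow]
    refine mul_le_mul_of_nonneg_left ?_ (by positivity)
    nlinarith [mul_nonneg (mul_nonneg hω.le ha) hb]
  have h1 : ‖y'‖ ≤ K * (ω * a + b) :=
    abs_le_of_sq_le_sq' (by nlinarith [mul_nonneg (sq_nonneg ω) (sq_nonneg ‖y‖)])
      (by positivity) |>.2
  have h2 : ω * ‖y‖ ≤ K * (ω * a + b) :=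
    abs_le_of_sq_le_sq' (by nlinarith [sq_nonneg ‖y'‖]) (by positivity) |>.2
  refine ⟨h1, ?_⟩
  rw [← mul_le_mul_iff_right₀ hω]
  refine h2.trans (le_of_eq ?_)
  field_simp

end Energy

/-! ### Fourier coefficients of periodic functions -/

open Complex in
theorem hasSum_fourierCoeffOn_of_periodic {L : ℝ} (hL : 0 < L) {g : ℝ → ℂ} (hg : Continuous g)
    (hp : Function.Periodic g L) (hs : Summable (fourierCoeffOn hL g)) (x : ℝ) :
    HasSum (fun n : ℤ => fourierCoeffOn hL g n * exp (I * ((2 * Real.pi * n / L : ℝ) * x)))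
      (g x) := by
  have : Fact (0 < L) := ⟨hL⟩
  have hc : Continuous (hp.lift : AddCircle L → ℂ) := hg.quotient_lift _
  let G : C(AddCircle L, ℂ) := ⟨hp.lift, hc⟩
  have hcoef : fourierCoeff G = fourierCoeffOn hL g := by
    ext n
    rw [fourierCoeff_eq_intervalIntegral _ _ 0, fourierCoeffOn_eq_integral]
    simp [G]
  have := has_pointwise_sum_fourier_series_of_summable (f := G) (by rwa [hcoef]) (x : AddCircle L)
  rw [hcoef] at this
  convert this using 1
  · ext n
    rw [fourier_coe_apply, smul_eq_mul]
    congr 2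
    push_cast
    ring
  · rfl

theorem norm_fourierCoeffOn_le {L : ℝ} (hL : 0 < L) (g : ℝ → ℂ) (n : ℤ) :
    ‖fourierCoeffOn hL g n‖ ≤ L⁻¹ * ∫ x in (0 : ℝ)..L, ‖g x‖ := by
  rw [fourierCoeffOn_eq_integral, norm_smul]
  simp only [sub_zero, one_div, norm_inv, Real.norm_eq_abs, abs_of_pos hL]
  refine mul_le_mul_of_nonneg_left ?_ (by positivity)
  refine (intervalIntegral.norm_integral_le_integral_norm hL.le).trans (le_of_eq ?_)
  refine intervalIntegral.integral_congr fun x _ => ?_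
  simp only [norm_smul, fourier_apply, Circle.norm_coe, one_mul]

/-- Integration by parts; the boundary term vanishes by periodicity. -/
theorem norm_fourierCoeffOn_of_hasDerivAt {L : ℝ} (hL : 0 < L) {g g' : ℝ → ℂ}
    (hg : ∀ x, HasDerivAt g (g' x) x) (hg' : Continuous g') (hp : Function.Periodic g L) {n : ℤ}
    (hn : n ≠ 0) :
    ‖fourierCoeffOn hL g n‖ * |2 * Real.pi * n / L| = ‖fourierCoeffOn hL g' n‖ := by
  have h0 : g L = g 0 := by simpa using hp 0
  rw [fourierCoeffOn_of_hasDerivAt hL hn (fun x _ => hg x) (hg'.intervalIntegrable _ _), h0]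
  have : |(n : ℝ)| ≠ 0 := by simpa using hn
  simp only [sub_self, mul_zero, zero_sub, norm_mul, norm_div, norm_neg, Complex.norm_real,
    Complex.norm_I, Complex.ofReal_zero, sub_zero, Complex.norm_intCast, abs_mul, abs_div]
  simp [abs_of_pos hL, abs_of_pos Real.pi_pos]
  field_simp

theorem periodic_deriv {g : ℝ → ℝ} {L : ℝ} (hp : Function.Periodic g L) :
    Function.Periodic (deriv g) L := by
  intro x
  rw [← deriv_comp_add_const]
  congr 1
  ext y
  exact hp y

theorem norm_fourierCoeffOn_mul_pow {L : ℝ} (hL : 0 < L) (k : ℕ) {g : ℝ → ℝ}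
    (hg : ContDiff ℝ k g) (hp : Function.Periodic g L) {n : ℤ} (hn : n ≠ 0) :
    ‖fourierCoeffOn hL (fun x => (g x : ℂ)) n‖ * |2 * Real.pi * n / L| ^ k =
      ‖fourierCoeffOn hL (fun x => ((iteratedDeriv k g x : ℝ) : ℂ)) n‖ := by
  induction k generalizing g with
  | zero => simp
  | succ k ih =>
    have h1 : ContDiff ℝ k (deriv g) := by
      have := (contDiff_succ_iff_deriv (n := (k : WithTop ℕ∞))).1 (by exact_mod_cast hg)
      exact this.2.2
    have hd : ∀ x, HasDerivAt (fun x => (g x : ℂ)) ((deriv g x : ℝ) : ℂ) x := fun x =>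
      ((hg.differentiable (by simp)) x).hasDerivAt.ofReal_comp
    rw [pow_succ', ← mul_assoc, norm_fourierCoeffOn_of_hasDerivAt hL hd
      (Complex.continuous_ofReal.comp h1.continuous) (fun x => by simp [hp x]) hn,
      ih h1 (periodic_deriv hp), iteratedDeriv_succ']

theorem norm_fourierCoeffOn_mul_pow_le {L : ℝ} (hL : 0 < L) (k : ℕ) {g : ℝ → ℝ}
    (hg : ContDiff ℝ k g) (hp : Function.Periodic g L) {n : ℤ} (hn : n ≠ 0) :
    ‖fourierCoeffOn hL (fun x => (g x : ℂ)) n‖ * |2 * Real.pi * n / L| ^ k ≤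
      L⁻¹ * ∫ x in (0 : ℝ)..L, |iteratedDeriv k g x| := by
  rw [norm_fourierCoeffOn_mul_pow hL k hg hp hn]
  refine (norm_fourierCoeffOn_le hL _ n).trans (le_of_eq ?_)
  simp

/-! ### Primitives and trigonometric series -/

theorem hasDerivAt_xOfZ {g : ℝ → ℝ} (hg : Continuous g) (z : ℝ) : HasDerivAt (xOfZ g) (g z) z :=
  intervalIntegral.integral_hasDerivAt_right (hg.intervalIntegrable _ _)
    (hg.stronglyMeasurableAtFilter _ _) hg.continuousAt

theorem xOfZ_add_period {g : ℝ → ℝ} {L : ℝ} (hg : Continuous g) (hp : Function.Periodic g L)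
    (z : ℝ) : xOfZ g (z + L) = xOfZ g z + ∫ u in (0 : ℝ)..L, g u := by
  unfold xOfZ
  rw [← intervalIntegral.integral_add_adjacent_intervals (hg.intervalIntegrable 0 z)
    (hg.intervalIntegrable z (z + L)), hp.intervalIntegral_add_eq z 0, zero_add]

/-- The `j`-th derivative of the trigonometric series with frequencies `κ n`, coefficients `e n`. -/
noncomputable def trigSeries (κ : ℤ → ℝ) (j : ℕ) (e : ℤ → ℂ) (z : ℝ) : ℂ :=
  ∑' n, e n * (Complex.I * κ n) ^ j * Complex.exp (Complex.I * (κ n * z))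

section TrigSeries

variable {κ : ℤ → ℝ} {u : ℤ → ℝ}

theorem norm_trigSeries_term (j : ℕ) (e : ℂ) (k z : ℝ) :
    ‖e * (Complex.I * k) ^ j * Complex.exp (Complex.I * (k * z))‖ = ‖e‖ * |k| ^ j := by
  rw [norm_mul, norm_mul, norm_pow, norm_mul, Complex.norm_I, one_mul, Complex.norm_real,
    Real.norm_eq_abs, mul_comm Complex.I, ← Complex.ofReal_mul, Complex.norm_exp_ofReal_mul_I,
    mul_one]

theorem summable_trigSeries (hu : Summable u) (j : ℕ) {e : ℤ → ℂ}
    (h : ∀ n, ‖e n‖ * |κ n| ^ j ≤ u n) (z : ℝ) :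
    Summable fun n => e n * (Complex.I * κ n) ^ j * Complex.exp (Complex.I * (κ n * z)) :=
  hu.of_norm_bounded fun n => (norm_trigSeries_term j (e n) (κ n) z).trans_le (h n)

theorem norm_trigSeries_le (hu : Summable u) (j : ℕ) {e : ℤ → ℂ}
    (h : ∀ n, ‖e n‖ * |κ n| ^ j ≤ u n) (z : ℝ) : ‖trigSeries κ j e z‖ ≤ ∑' n, u n :=
  tsum_of_norm_bounded hu.hasSum fun n => (norm_trigSeries_term j (e n) (κ n) z).trans_le (h n)

theorem hasDerivAt_trigSeries_space (hu : Summable u) (j : ℕ) {e : ℤ → ℂ}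
    (h : ∀ n, ‖e n‖ * |κ n| ^ j ≤ u n) (h' : ∀ n, ‖e n‖ * |κ n| ^ (j + 1) ≤ u n) (z : ℝ) :
    HasDerivAt (trigSeries κ j e) (trigSeries κ (j + 1) e z) z := by
  refine hasDerivAt_tsum_of_isPreconnected hu isOpen_univ isPreconnected_univ
    (fun n y _ => ?_) (fun n y _ => (norm_trigSeries_term (j + 1) (e n) (κ n) y).trans_le (h' n))
    (mem_univ z) (summable_trigSeries hu j h z) (mem_univ z)
  have h1 : HasDerivAt (fun y : ℝ => Complex.I * (κ n * (y : ℂ))) (Complex.I * κ n) y := by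
    simpa using (((hasDerivAt_id y).ofReal_comp).const_mul (κ n : ℂ)).const_mul Complex.I
  exact (h1.cexp.const_mul (e n * (Complex.I * κ n) ^ j)).congr_deriv (by ring)

/-- Termwise differentiation needs one summable majorant on an open connected set of times, here
(-1, ∞). -/
theorem hasDerivAt_trigSeries_time (hu : Summable u) (j : ℕ) {d d' : ℤ → ℝ → ℂ}
    (hd : ∀ n t, HasDerivAt (d n) (d' n t) t)
    (h : ∀ n t, -1 < t → ‖d n t‖ * |κ n| ^ j ≤ u n)
    (h' : ∀ n t, -1 < t → ‖d' n t‖ * |κ n| ^ j ≤ u n) (z : ℝ) {t : ℝ} (ht : -1 < t) :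
    HasDerivAt (fun s => trigSeries κ j (fun n => d n s) z)
      (trigSeries κ j (fun n => d' n t) z) t := by
  refine hasDerivAt_tsum_of_isPreconnected (t := Ioi (-1 : ℝ)) hu isOpen_Ioi isPreconnected_Ioi
    (fun n s _ => ?_)
    (fun n s hs => (norm_trigSeries_term j (d' n s) (κ n) z).trans_le (h' n s hs))
    ht (summable_trigSeries hu j (fun n => h n t ht) z) ht
  exact ((hd n s).mul_const _).mul_const _

theorem hasDerivAt_re {h : ℝ → ℂ} {h' : ℂ} {t : ℝ} (hh : HasDerivAt h h' t) :
    HasDerivAt (fun s => (h s).re) h'.re t :=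
  Complex.reCLM.hasFDerivAt.comp_hasDerivAt t hh

end TrigSeries

/-! ### Fourier solution of the damped string -/

/-- A motion `g(t,z)` of the continuous string with its derivatives: `g_tt + α g_t = c² g_zz + f`
for `t > -1`. -/
structure IsStringMotion (L c α : ℝ) (f : ℝ → ℝ)
    (g g_t g_z g_tt g_tz g_zz : ℝ → ℝ → ℝ) : Prop where
  deriv_t : ∀ t z, -1 < t → HasDerivAt (fun s => g s z) (g_t t z) t
  deriv_z : ∀ t z, -1 < t → HasDerivAt (g t) (g_z t z) z
  deriv_tt : ∀ t z, -1 < t → HasDerivAt (fun s => g_t s z) (g_tt t z) t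
  deriv_zt : ∀ t z, -1 < t → HasDerivAt (fun s => g_z s z) (g_tz t z) t
  deriv_tz : ∀ t z, -1 < t → HasDerivAt (g_t t) (g_tz t z) z
  deriv_zz : ∀ t z, -1 < t → HasDerivAt (g_z t) (g_zz t z) z
  eqn : ∀ t z, -1 < t → g_tt t z = c ^ 2 * g_zz t z - α * g_t t z + f t
  add_period : ∀ t z, -1 < t → g t (z + L) = g t z + L
  lipschitz : ∃ K, 0 ≤ K ∧ ∀ t z z', -1 < t → |g_zz t z - g_zz t z'| ≤ K * |z - z'|

/-- The equation `φ'' + α φ' = f` has a global solution for all initial data. -/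
theorem exists_mean_motion (α : ℝ) {f : ℝ → ℝ} (hf : Continuous f) (a b : ℝ) :
    ∃ φ φ' : ℝ → ℝ, φ 0 = a ∧ φ' 0 = b ∧ (∀ t, HasDerivAt φ (φ' t) t) ∧
      ∀ t, HasDerivAt φ' (-(α * φ' t) + f t) t := by
  have hF : Continuous fun s => Real.exp (α * s) * f s := by fun_prop
  set F : ℝ → ℝ := xOfZ fun s => Real.exp (α * s) * f s with hFdef
  have hFd := hasDerivAt_xOfZ hF
  -- Variation of constants for φ'.
  set p : ℝ → ℝ := fun t => Real.exp (-(α * t)) * (b + F t) with hp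
  have hpd : ∀ t, HasDerivAt p (-(α * p t) + f t) t := by
    intro t
    have := ((((hasDerivAt_id t).const_mul α).neg).exp).mul ((hFd t).const_add b)
    refine this.congr_deriv ?_
    have h1 : Real.exp (-(α * t)) * Real.exp (α * t) = 1 := by
      rw [← Real.exp_add]; simp
    simp only [hp, id]
    linear_combination f t * h1
  have hpc : Continuous p := continuous_iff_continuousAt.2 fun t => (hpd t).continuousAt
  refine ⟨fun t => a + xOfZ p t, p, by simp [xOfZ], by simp [hp, hFdef, xOfZ], fun t => ?_, hpd⟩
  exact (hasDerivAt_xOfZ hpc t).const_add a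

/-- Motions of the string from summable Fourier coefficients of the initial data. -/
theorem exists_isStringMotion {L c α : ℝ} (hL : 0 < L) (hc : 0 < c) (hα : 0 ≤ α) {f : ℝ → ℝ}
    (hf : Continuous f) (a b : ℤ → ℂ) (a₀ b₀ : ℝ) (ha₀ : a 0 = 0) (hb₀ : b 0 = 0) {u : ℤ → ℝ}
    (hu : Summable u)
    (ha : ∀ n, ∀ j ≤ 3, ‖a n‖ * |2 * Real.pi * n / L| ^ j ≤ u n)
    (hb : ∀ n, ∀ j ≤ 3, ‖b n‖ * |2 * Real.pi * n / L| ^ j ≤ u n) :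
    ∃ g g_t g_z g_tt g_tz g_zz : ℝ → ℝ → ℝ, IsStringMotion L c α f g g_t g_z g_tt g_tz g_zz ∧
      (∀ z, g 0 z = z + a₀ + (trigSeries (fun n => 2 * Real.pi * n / L) 0 a z).re) ∧
      (∀ z, g_t 0 z = b₀ + (trigSeries (fun n => 2 * Real.pi * n / L) 0 b z).re) ∧
      ∀ w : ℤ → ℝ, Summable w →
        (∀ n, n ≠ 0 → (‖a n‖ + ‖b n‖ / (c * |2 * Real.pi * n / L|)) * |2 * Real.pi * n / L| ≤ w n) →
        0 ≤ w 0 → ∀ t z, 0 ≤ t → |g_z t z - 1| ≤ ∑' n, w n := by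
  set κ : ℤ → ℝ := fun n => 2 * Real.pi * n / L with hκ
  obtain ⟨φ, φ', hφ0, hφ'0, hφd, hφ'd⟩ := exists_mean_motion α hf a₀ b₀
  have hκ0 : κ 0 = 0 := by simp [hκ]
  -- The mode n = 0 is taken to be zero: its frequency vanishes, so the energy does not control it,
  -- and the mean is carried by φ.
  have hex : ∀ n : ℤ, ∃ y y' : ℝ → ℂ, y 0 = a n ∧ y' 0 = b n ∧ (∀ t, HasDerivAt y (y' t) t) ∧
      (∀ t, HasDerivAt y' (-(α * y' t) - ((c * |κ n| : ℝ) : ℂ) ^ 2 * y t) t) ∧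
      (n = 0 → y = 0 ∧ y' = 0) := by
    intro n
    rcases eq_or_ne n 0 with rfl | hn
    · refine ⟨0, 0, ha₀.symm, hb₀.symm, fun t => hasDerivAt_const t 0, fun t => ?_,
        fun _ => ⟨rfl, rfl⟩⟩
      simp
    · obtain ⟨y, y', h1, h2, h3, h4⟩ := exists_damped_oscillation α (c * |κ n|) (a n) (b n)
      exact ⟨y, y', h1, h2, h3, h4, fun h => absurd h hn⟩
  choose d d' hd0 hd'0 hd hd' hdz using hex
  set d'' : ℤ → ℝ → ℂ := fun n t => -(α * d' n t) - ((c * |κ n| : ℝ) : ℂ) ^ 2 * d n t with hd''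
  have hκpos : ∀ n, n ≠ 0 → 0 < |κ n| := fun n hn => by
    have : (n : ℝ) ≠ 0 := by exact_mod_cast hn
    simp only [hκ]; positivity
  have hκge : ∀ n, n ≠ 0 → L / (2 * Real.pi) * |κ n| ≥ 1 := fun n hn => by
    have h1 : (1 : ℝ) ≤ |(n : ℝ)| := by exact_mod_cast Int.one_le_abs hn
    simp only [hκ, abs_div, abs_mul, abs_of_pos hL, abs_of_pos Real.pi_pos, Nat.abs_ofNat]
    field_simp
    exact h1
  -- The reciprocal of the smallest nonzero |κ n|; it absorbs the division by the frequency in the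
  -- bound for d.
  set m := L / (2 * Real.pi) with hm
  have hm0 : 0 < m := by positivity
  have hen : ∀ n t, -1 < t → ‖d' n t‖ ^ 2 + (c * |κ n|) ^ 2 * ‖d n t‖ ^ 2 ≤
      Real.exp α ^ 2 * (‖b n‖ ^ 2 + (c * |κ n|) ^ 2 * ‖a n‖ ^ 2) := by
    intro n t ht
    have := oscillation_energy_le_exp hα (hd n) (hd' n) ht
    rwa [hd0, hd'0, two_mul, Real.exp_add, ← pow_two] at this
  have hu0 : ∀ n, 0 ≤ u n := fun n => le_trans (by positivity) (ha n 0 (by norm_num))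
  set E := Real.exp α with hE
  have hE0 : 0 < E := Real.exp_pos _
  -- The three brackets serve d, d' and d'' in turn, so that D * u is a common majorant.
  set D := E * ((1 + m / c) + (c + 1) + (α * c + α + c ^ 2 + c)) with hD
  have hcoef : ∀ n t, -1 < t → ‖d' n t‖ ≤ E * (c * (‖a n‖ * |κ n|) + ‖b n‖) ∧
      ‖d n t‖ ≤ E * (‖a n‖ + m / c * ‖b n‖) := by
    intro n t ht
    rcases eq_or_ne n 0 with rfl | hn
    · simp [(hdz 0 rfl).1, (hdz 0 rfl).2, ha₀, hb₀]
    · have h := oscillation_bounds_of_energy (mul_pos hc (hκpos n hn)) hE0.le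
        (norm_nonneg (a n)) (norm_nonneg (b n)) (hen n t ht)
      refine ⟨h.1.trans (le_of_eq (by ring)), h.2.trans ?_⟩
      gcongr
      rw [div_le_iff₀ (mul_pos hc (hκpos n hn))]
      have : m / c * ‖b n‖ * (c * |κ n|) = ‖b n‖ * (m * |κ n|) := by field_simp
      rw [this]
      exact le_mul_of_one_le_right (norm_nonneg _) (hκge n hn)
  have hmc : 0 < m / c := by positivity
  -- Each time derivative costs one power of κ: three powers are left for d, two for d' and one for
  -- d''.
  have hb1 : ∀ n t j, -1 < t → j ≤ 3 → ‖d n t‖ * |κ n| ^ j ≤ D * u n := by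
    intro n t j ht hj
    have h1 := ha n j hj
    have h2 := hb n j hj
    have h0 := hu0 n
    calc ‖d n t‖ * |κ n| ^ j ≤ E * (‖a n‖ + m / c * ‖b n‖) * |κ n| ^ j := by
          gcongr; exact (hcoef n t ht).2
      _ = E * (‖a n‖ * |κ n| ^ j + m / c * (‖b n‖ * |κ n| ^ j)) := by ring
      _ ≤ E * (u n + m / c * u n) := by gcongr
      _ = E * (1 + m / c) * u n := by ring
      _ ≤ D * u n := by
          have : 0 ≤ (c + 1) + (α * c + α + c ^ 2 + c) := by positivity
          rw [hD]
          refine mul_le_mul_of_nonneg_right (mul_le_mul_of_nonneg_left ?_ hE0.le) h0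
          linarith
  have hb2 : ∀ n t j, -1 < t → j ≤ 2 → ‖d' n t‖ * |κ n| ^ j ≤ D * u n := by
    intro n t j ht hj
    have h1 := ha n (j + 1) (by omega)
    have h2 := hb n j (by omega)
    have h0 := hu0 n
    calc ‖d' n t‖ * |κ n| ^ j ≤ E * (c * (‖a n‖ * |κ n|) + ‖b n‖) * |κ n| ^ j := by
          gcongr; exact (hcoef n t ht).1
      _ = E * (c * (‖a n‖ * |κ n| ^ (j + 1)) + ‖b n‖ * |κ n| ^ j) := by ring
      _ ≤ E * (c * u n + u n) := by gcongr
      _ = E * (c + 1) * u n := by ring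
      _ ≤ D * u n := by
          have : 0 ≤ (1 + m / c) + (α * c + α + c ^ 2 + c) := by positivity
          rw [hD]
          refine mul_le_mul_of_nonneg_right (mul_le_mul_of_nonneg_left ?_ hE0.le) h0
          linarith
  have hb3 : ∀ n t j, -1 < t → j ≤ 1 → ‖d'' n t‖ * |κ n| ^ j ≤ D * u n := by
    intro n t j ht hj
    have h0 := hu0 n
    have h1 := ha n (j + 1) (by omega)
    have h2 := hb n j (by omega)
    have h3 := ha n (j + 2) (by omega)
    have h4 := hb n (j + 1) (by omega)
    have hw : (c * |κ n|) * ‖d n t‖ ≤ E * (c * (‖a n‖ * |κ n|) + ‖b n‖) := by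
      rcases eq_or_ne n 0 with rfl | hn
      · simp [(hdz 0 rfl).1, ha₀, hb₀]
      · have h := oscillation_bounds_of_energy (mul_pos hc (hκpos n hn)) hE0.le
          (norm_nonneg (a n)) (norm_nonneg (b n)) (hen n t ht)
        refine (mul_le_mul_of_nonneg_left h.2 (mul_pos hc (hκpos n hn)).le).trans (le_of_eq ?_)
        have := (hκpos n hn).ne'
        field_simp
    have h5 : ‖d'' n t‖ ≤ (α + c * |κ n|) * (E * (c * (‖a n‖ * |κ n|) + ‖b n‖)) := by
      calc ‖d'' n t‖ ≤ α * ‖d' n t‖ + (c * |κ n|) * ((c * |κ n|) * ‖d n t‖) := by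
            refine (norm_sub_le _ _).trans (le_of_eq ?_)
            rw [norm_neg, norm_mul, norm_mul, norm_pow, Complex.norm_real, Complex.norm_real,
              Real.norm_of_nonneg hα, Real.norm_of_nonneg (by positivity)]
            ring
        _ ≤ α * (E * (c * (‖a n‖ * |κ n|) + ‖b n‖)) +
            (c * |κ n|) * (E * (c * (‖a n‖ * |κ n|) + ‖b n‖)) := by
            gcongr; exact (hcoef n t ht).1
        _ = _ := by ring
    calc ‖d'' n t‖ * |κ n| ^ j
        ≤ (α + c * |κ n|) * (E * (c * (‖a n‖ * |κ n|) + ‖b n‖)) * |κ n| ^ j := by gcongr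
      _ = E * (α * c * (‖a n‖ * |κ n| ^ (j + 1)) + α * (‖b n‖ * |κ n| ^ j) +
            c ^ 2 * (‖a n‖ * |κ n| ^ (j + 2)) + c * (‖b n‖ * |κ n| ^ (j + 1))) := by ring
      _ ≤ E * (α * c * u n + α * u n + c ^ 2 * u n + c * u n) := by gcongr
      _ = E * (α * c + α + c ^ 2 + c) * u n := by ring
      _ ≤ D * u n := by
          have : 0 ≤ (1 + m / c) + (c + 1) := by positivity
          rw [hD]
          refine mul_le_mul_of_nonneg_right (mul_le_mul_of_nonneg_left ?_ hE0.le) h0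
          linarith
  have hDu : Summable fun n => D * u n := hu.mul_left D
  refine ⟨fun t z => z + φ t + (trigSeries κ 0 (fun n => d n t) z).re,
    fun t z => φ' t + (trigSeries κ 0 (fun n => d' n t) z).re,
    fun t z => 1 + (trigSeries κ 1 (fun n => d n t) z).re,
    fun t z => (-(α * φ' t) + f t) + (trigSeries κ 0 (fun n => d'' n t) z).re,
    fun t z => (trigSeries κ 1 (fun n => d' n t) z).re,
    fun t z => (trigSeries κ 2 (fun n => d n t) z).re, ?_, ?_, ?_, ?_⟩
  · constructor
    · intro t z ht
      exact ((hφd t).const_add z).add (hasDerivAt_re (hasDerivAt_trigSeries_time hDu 0 hd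
        (fun n t ht => hb1 n t 0 ht (by norm_num)) (fun n t ht => hb2 n t 0 ht (by norm_num)) z ht))
    · intro t z ht
      exact ((hasDerivAt_id z).add_const (φ t)).add (hasDerivAt_re
        (hasDerivAt_trigSeries_space hDu 0 (fun n => hb1 n t 0 ht (by norm_num))
          (fun n => hb1 n t 1 ht (by norm_num)) z))
    · intro t z ht
      exact (hφ'd t).add (hasDerivAt_re (hasDerivAt_trigSeries_time hDu 0 hd'
        (fun n t ht => hb2 n t 0 ht (by norm_num)) (fun n t ht => hb3 n t 0 ht (by norm_num)) z ht))
    · intro t z ht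
      exact (hasDerivAt_re (hasDerivAt_trigSeries_time hDu 1 hd
        (fun n t ht => hb1 n t 1 ht (by norm_num))
        (fun n t ht => hb2 n t 1 ht (by norm_num)) z ht)).const_add 1
    · intro t z ht
      exact (hasDerivAt_re (hasDerivAt_trigSeries_space hDu 0 (fun n => hb2 n t 0 ht (by norm_num))
          (fun n => hb2 n t 1 ht (by norm_num)) z)).const_add (φ' t)
    · intro t z ht
      exact (hasDerivAt_re (hasDerivAt_trigSeries_space hDu 1 (fun n => hb1 n t 1 ht (by norm_num))
          (fun n => hb1 n t 2 ht (by norm_num)) z)).const_add 1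
    · intro t z ht
      -- Since (iκ)² = -κ², the restoring force of the modes sums to c² times the second space
      -- derivative.
      have h1 : trigSeries κ 0 (fun n => d'' n t) z = -(α * trigSeries κ 0 (fun n => d' n t) z) +
          (c ^ 2 : ℝ) * trigSeries κ 2 (fun n => d n t) z := by
        unfold trigSeries
        rw [← tsum_mul_left, ← tsum_mul_left, ← tsum_neg, ← Summable.tsum_add]
        · refine tsum_congr fun n => ?_
          have h2 : ((|κ n| : ℝ) : ℂ) ^ 2 = (κ n : ℂ) ^ 2 := by
            rw [← Complex.ofReal_pow, sq_abs, Complex.ofReal_pow]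
          simp only [hd'', Complex.ofReal_mul, mul_pow, h2, Complex.I_sq, Complex.ofReal_pow]
          ring
        · exact ((summable_trigSeries hDu 0 (fun n => hb2 n t 0 ht (by norm_num)) z).mul_left _).neg
        · exact (summable_trigSeries hDu 2 (fun n => hb1 n t 2 ht (by norm_num)) z).mul_left _
      simp only [h1, Complex.add_re, Complex.neg_re, Complex.re_ofReal_mul]
      ring
    · intro t z ht
      have h1 : trigSeries κ 0 (fun n => d n t) (z + L) = trigSeries κ 0 (fun n => d n t) z := by
        refine tsum_congr fun n => ?_
        congr 1
        rw [Complex.exp_eq_exp_iff_exists_int]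
        refine ⟨n, ?_⟩
        have : (L : ℂ) ≠ 0 := by exact_mod_cast hL.ne'
        simp only [hκ]
        push_cast
        field_simp
      simp only [h1]
      ring
    -- The Lipschitz constant is the majorant of the third space derivative, the reason for asking j
    -- ≤ 3.
    · have hnn : 0 ≤ ∑' n, D * u n := tsum_nonneg fun n => by
        have := hu0 n
        positivity
      refine ⟨∑' n, D * u n, hnn, fun t z z' ht => ?_⟩
      rw [← Complex.sub_re]
      refine (Complex.abs_re_le_norm _).trans ?_
      exact Convex.norm_image_sub_le_of_norm_hasDerivWithin_le (s := univ)
        (fun y _ => (hasDerivAt_trigSeries_space hDu 2 (fun n => hb1 n t 2 ht (by norm_num))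
          (fun n => hb1 n t 3 ht (by norm_num)) y).hasDerivWithinAt)
        (fun y _ => norm_trigSeries_le hDu 3 (fun n => hb1 n t 3 ht (by norm_num)) y)
        convex_univ (mem_univ _) (mem_univ _)
  · intro z
    simp only [hφ0, hd0]
  · intro z
    simp only [hφ'0, hd'0]
  · intro w hw h1 hw0 t z ht
    simp only [add_sub_cancel_left]
    refine (Complex.abs_re_le_norm _).trans (norm_trigSeries_le hw 1 (fun n => ?_) z)
    rcases eq_or_ne n 0 with rfl | hn
    · simp [hκ0, hw0]
    · refine le_trans ?_ (h1 n hn)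
      rw [pow_one]
      refine mul_le_mul_of_nonneg_right ?_ (abs_nonneg _)
      -- For t ≥ 0 the energy does not increase, so no factor exp α enters and the bound can be
      -- compared with γ < 1.
      have := oscillation_energy_le hα (hd n) (hd' n) ht
      rw [hd0, hd'0] at this
      simpa using (oscillation_bounds_of_energy (K := 1) (mul_pos hc (hκpos n hn)) zero_le_one
        (norm_nonneg (a n)) (norm_nonneg (b n)) (by simpa using this)).2

/-! ### Initial profiles and uniform monotonicity -/

/-- The term n = 0 is `1 / 0 = 0`, so the sum is 2ζ(2). -/
theorem hasSum_one_div_int_sq : HasSum (fun n : ℤ => 1 / (n : ℝ) ^ 2) (Real.pi ^ 2 / 3) := by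
  have h1 : HasSum (fun n : ℕ => 1 / ((n : ℤ) : ℝ) ^ 2) (Real.pi ^ 2 / 6) := by
    simpa using hasSum_zeta_two
  have h2 : HasSum (fun n : ℕ => 1 / ((Int.negSucc n : ℤ) : ℝ) ^ 2) (Real.pi ^ 2 / 6) := by
    have := (hasSum_nat_add_iff' 1).2 hasSum_zeta_two
    simp only [Finset.range_one, Finset.sum_singleton, Nat.cast_zero, ne_eq, OfNat.ofNat_ne_zero,
      not_false_eq_true, zero_pow, div_zero, sub_zero] at this
    refine this.congr_fun fun n => ?_
    rw [Int.cast_negSucc]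
    push_cast
    ring
  convert h1.int_rec h2 using 1
  · ext n
    cases n <;> rfl
  · ring

/-- Fourier expansion of the primitive of a periodic function with mean value `0`. -/
theorem exists_fourier_primitive {L : ℝ} (hL : 0 < L) {q : ℝ → ℝ} (hq : ContDiff ℝ 4 q)
    (hp : Function.Periodic q L) (h0 : ∫ u in (0 : ℝ)..L, q u = 0) :
    ∃ (a : ℤ → ℂ) (a₀ K : ℝ), 0 ≤ K ∧ a 0 = 0 ∧
      (∀ z, xOfZ q z = a₀ + (trigSeries (fun n => 2 * Real.pi * n / L) 0 a z).re) ∧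
      (∀ n, ∀ j ≤ 3, ‖a n‖ * |2 * Real.pi * n / L| ^ j ≤ K * (1 / (n : ℝ) ^ 2)) ∧
      ∀ n, ‖a n‖ * |2 * Real.pi * n / L| ^ 3 ≤ L⁻¹ * ∫ u in (0 : ℝ)..L, |iteratedDeriv 2 q u| := by
  have hd : deriv (xOfZ q) = q := funext fun z => (hasDerivAt_xOfZ hq.continuous z).deriv
  have hP : ContDiff ℝ (5 : ℕ) (xOfZ q) := by
    rw [show ((5 : ℕ) : WithTop ℕ∞) = 4 + 1 by norm_num, contDiff_succ_iff_deriv]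
    exact ⟨fun z => (hasDerivAt_xOfZ hq.continuous z).differentiableAt, by simp, by rwa [hd]⟩
  have hPp : Function.Periodic (xOfZ q) L := fun z => by
    rw [xOfZ_add_period hq.continuous hp, h0, add_zero]
  set P : ℝ → ℂ := fun x => (xOfZ q x : ℂ) with hPdef
  set κ : ℤ → ℝ := fun n => 2 * Real.pi * n / L with hκ
  -- The mean is moved from the series into the constant a₀.
  set a : ℤ → ℂ := fun n => if n = 0 then 0 else fourierCoeffOn hL P n with ha
  have ha0 : a 0 = 0 := by simp [ha]
  have han : ∀ n, n ≠ 0 → a n = fourierCoeffOn hL P n := fun n hn => by simp [ha, hn]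
  set M := L⁻¹ * ∫ x in (0 : ℝ)..L, |iteratedDeriv 5 (xOfZ q) x| with hM
  have hM0 : 0 ≤ M := by
    have : 0 ≤ ∫ x in (0 : ℝ)..L, |iteratedDeriv 5 (xOfZ q) x| :=
      intervalIntegral.integral_nonneg hL.le fun _ _ => abs_nonneg _
    positivity
  set m := L / (2 * Real.pi) with hm
  have hm0 : 0 < m := by positivity
  have hmκ : ∀ n : ℤ, |κ n| = |(n : ℝ)| / m := fun n => by
    simp only [hκ, hm, abs_div, abs_mul, abs_of_pos hL, abs_of_pos Real.pi_pos, Nat.abs_ofNat]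
    field_simp
  set K := M * (m ^ 5 + m ^ 4 + m ^ 3 + m ^ 2) with hK
  have hK0 : 0 ≤ K := by positivity
  -- Of the five powers of decay, at most three pay for |κ n|^j and two for 1/n²; K adds the powers
  -- m^(5-j) for j = 0, …, 3.
  have hbound : ∀ n, ∀ j ≤ 3, ‖a n‖ * |κ n| ^ j ≤ K * (1 / (n : ℝ) ^ 2) := by
    intro n j hj
    rcases eq_or_ne n 0 with rfl | hn
    · simp [ha0]
    have h5 := norm_fourierCoeffOn_mul_pow_le hL 5 hP hPp hn
    rw [← hM] at h5
    change ‖fourierCoeffOn hL P n‖ * |κ n| ^ 5 ≤ M at h5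
    rw [← han n hn, hmκ] at h5
    have h1 : (1 : ℝ) ≤ |(n : ℝ)| := by exact_mod_cast Int.one_le_abs hn
    rw [hmκ, ← sq_abs (n : ℝ), mul_one_div, le_div_iff₀ (by positivity)]
    set x := |(n : ℝ)|
    calc ‖a n‖ * (x / m) ^ j * x ^ 2 ≤ ‖a n‖ * (x / m) ^ j * x ^ (5 - j) := by
          gcongr ?_ * ?_
          exact pow_le_pow_right₀ h1 (by omega)
      _ = ‖a n‖ * (x / m) ^ 5 * m ^ (5 - j) := by
          interval_cases j <;> field_simp <;> ring_nf
      _ ≤ M * m ^ (5 - j) := by gcongr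
      _ ≤ K := by
          rw [hK]
          gcongr
          have := pow_pos hm0 2
          have := pow_pos hm0 3
          have := pow_pos hm0 4
          have := pow_pos hm0 5
          interval_cases j <;> norm_num <;> linarith
  have hsum : Summable a := by
    refine (hasSum_one_div_int_sq.summable.mul_left K).of_norm_bounded fun n => ?_
    simpa using hbound n 0 (by norm_num)
  have hsum' : Summable (fourierCoeffOn hL P) := by
    have := hsum.add (hasSum_ite_eq (0 : ℤ) (fourierCoeffOn hL P 0)).summable
    refine this.congr fun n => ?_
    by_cases hn : n = 0 <;> simp [ha, hn]
  refine ⟨a, (fourierCoeffOn hL P 0).re, K, hK0, ha0, fun z => ?_, hbound, fun n => ?_⟩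
  · have h := hasSum_fourierCoeffOn_of_periodic hL
      (Complex.continuous_ofReal.comp hP.continuous) (fun x => by simp [hPp x]) hsum' z
    have h' := hasSum_ite_sub_hasSum h 0
    have : trigSeries κ 0 a z = P z - fourierCoeffOn hL P 0 := by
      have e : trigSeries κ 0 a z = _ := Eq.trans (tsum_congr fun n => ?_) h'.tsum_eq
      · rw [e]
        simp [P, Function.comp_def]
      · by_cases hn : n = 0 <;> simp [ha, hn, hκ, P, Function.comp_def]
    rw [this]
    simp [P]
  · rcases eq_or_ne n 0 with rfl | hn
    · rw [ha0, norm_zero, zero_mul]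
      have : 0 ≤ ∫ x in (0 : ℝ)..L, |iteratedDeriv 2 q x| :=
        intervalIntegral.integral_nonneg hL.le fun _ _ => abs_nonneg _
      positivity
    -- The third derivative of the primitive is q''.
    · have := norm_fourierCoeffOn_mul_pow_le hL 3 (hP.of_le (by norm_num)) hPp hn
      rwa [iteratedDeriv_succ', hd, ← han n hn] at this

/-- Isolates the part of γ that controls g_z; the remaining summands are nonnegative. -/
theorem gammaConst_ge {L ω₀ α : ℝ} (hL : 0 < L) (hω₀ : 0 < ω₀) (hα : 0 ≤ α) (X V : ℝ → ℝ)
    {C₁ C₂ : ℝ} (hC₁ : 0 < C₁) (hC₂ : 0 < C₂) :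
    2 * fluct L X + fluct L V / (2 * ω₀) ≤ gammaConst L ω₀ α X V C₁ C₂ := by
  have hf : ∀ g : ℝ → ℝ, 0 ≤ fluct L g := fun g =>
    mul_nonneg hL.le (intervalIntegral.integral_nonneg hL.le fun _ _ => abs_nonneg _)
  have h1 := hf X
  have h2 : 0 ≤ C₁ * L⁻¹ := by positivity
  have h3 : 0 ≤ α / (8 * ω₀) := by positivity
  have h4 : 0 ≤ C₂ * L⁻¹ / (4 * ω₀) := by positivity
  have h5 : fluct L V / (2 * ω₀) = 2 * fluct L V / (4 * ω₀) := by field_simp; norm_num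
  unfold gammaConst
  rw [h5, add_div]
  nlinarith [mul_nonneg h3 (add_nonneg (mul_nonneg zero_le_two h1) h2)]

/-- The string motion with initial gaps `X` and velocity differences `V` exists and remains
uniformly monotone. -/
theorem exists_profile_motion {L ω₀ α : ℝ} (hL : 0 < L) (hω₀ : 0 < ω₀) (hα : 0 ≤ α)
    {f : ℝ → ℝ} (hf : Continuous f) {X V : ℝ → ℝ} (hXV : IsProfile L X V)
    {C₁ C₂ : ℝ} (hC₁ : 0 < C₁) (hC₂ : 0 < C₂)
    (hγ : gammaConst L ω₀ α X V C₁ C₂ < 1) (v : ℝ) :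
    ∃ g g_t g_z g_tt g_tz g_zz : ℝ → ℝ → ℝ,
      IsStringMotion L (ω₀ * L) α f g g_t g_z g_tt g_tz g_zz ∧
      (∀ z, g 0 z = xOfZ X z) ∧ (∀ z, g_t 0 z = v + xOfZ V z) ∧
      ∃ m, 0 < m ∧ ∀ t z, 0 ≤ t → m ≤ g_z t z := by
  have hXc := hXV.contDiff_X.continuous
  -- The deviation of ∫₀ᶻ X from z is periodic because X - 1 has mean zero.
  have hX1 : ContDiff ℝ 4 fun u => X u - 1 := hXV.contDiff_X.sub contDiff_const
  have hxz : ∀ z, xOfZ (fun u => X u - 1) z = xOfZ X z - z := fun z => by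
    unfold xOfZ
    rw [intervalIntegral.integral_sub (hXc.intervalIntegrable _ _) (by simp)]
    simp
  have hi : iteratedDeriv 2 (fun u => X u - 1) = iteratedDeriv 2 X := by
    rw [iteratedDeriv_succ', iteratedDeriv_succ' (f := X)]
    congr 1
    ext x
    simp
  obtain ⟨a, a₀, K, hK, ha0, haP, haK, haX⟩ := exists_fourier_primitive hL hX1
    (fun u => by simp [hXV.periodic_X u])
    ((hxz L).trans (by simp [xOfZ, hXV.integral_X]))
  obtain ⟨b, b₀, K', hK', hb0, hbP, hbK, hbV⟩ := exists_fourier_primitive hL hXV.contDiff_V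
    hXV.periodic_V hXV.integral_V
  rw [hi] at haX
  have hs := hasSum_one_div_int_sq
  obtain ⟨g, g_t, g_z, g_tt, g_tz, g_zz, hg, hg0, hgt0, hgz⟩ :=
    exists_isStringMotion (c := ω₀ * L) hL (by positivity) hα hf a b a₀ (v + b₀) ha0 hb0
      (hs.summable.mul_left (K + K'))
      (fun n j hj => (haK n j hj).trans (by gcongr; linarith))
      (fun n j hj => (hbK n j hj).trans (by gcongr; linarith))
  refine ⟨g, g_t, g_z, g_tt, g_tz, g_zz, hg, fun z => ?_, fun z => ?_, ?_⟩
  · rw [hg0]; linarith [haP z, hxz z]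
  · rw [hgt0, hbP]; ring
  set c₁ := fluct L X with hc₁
  set c₂ := fluct L V with hc₂
  have hc₁0 : 0 ≤ c₁ :=
    mul_nonneg hL.le (intervalIntegral.integral_nonneg hL.le fun _ _ => abs_nonneg _)
  have hc₂0 : 0 ≤ c₂ :=
    mul_nonneg hL.le (intervalIntegral.integral_nonneg hL.le fun _ _ => abs_nonneg _)
  have hI₁ : L⁻¹ * ∫ u in (0 : ℝ)..L, |iteratedDeriv 2 X u| = c₁ / L ^ 2 := by
    rw [hc₁, fluct]; field_simp
  have hI₂ : L⁻¹ * ∫ u in (0 : ℝ)..L, |iteratedDeriv 2 V u| = c₂ / L ^ 2 := by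
    rw [hc₂, fluct]; field_simp
  -- As |κ n| = 2π|n|/L ≥ 6|n|/L, the bounds ‖a n‖|κ|³ ≤ c₁/L² and ‖b n‖|κ|³ ≤ c₂/L² give the
  -- factors 6² = 36 and 6³ = 216.
  set B := c₁ / 36 + c₂ / (216 * ω₀) with hB
  have hB0 : 0 ≤ B := by positivity
  have hpi := Real.pi_gt_three
  have key := hgz (fun n => B * (1 / (n : ℝ) ^ 2)) (hs.summable.mul_left B) (fun n hn => ?_)
    (by simp)
  · rw [tsum_mul_left, hs.tsum_eq] at key
    have hγ' := gammaConst_ge hL hω₀ hα X V hC₁ hC₂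
    have hlt : B * (Real.pi ^ 2 / 3) < 1 := by
      have h1 : Real.pi ^ 2 / 3 ≤ 4 := by nlinarith [Real.pi_lt_d2]
      have h2 : B * 4 ≤ 2 * c₁ + c₂ / (2 * ω₀) := by
        have h3 : c₂ / (216 * ω₀) * 108 = c₂ / (2 * ω₀) := by field_simp; ring
        have h4 : 0 ≤ c₂ / (216 * ω₀) := by positivity
        rw [hB]
        linarith
      nlinarith
    refine ⟨1 - B * (Real.pi ^ 2 / 3), by linarith, fun t z ht => ?_⟩
    have := (abs_le.1 (key t z ht)).1
    linarith
  · have h1 := haX n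
    have h2 := hbV n
    rw [hI₁] at h1
    rw [hI₂] at h2
    have hn1 : (1 : ℝ) ≤ |(n : ℝ)| := by exact_mod_cast Int.one_le_abs hn
    have hκ : |2 * Real.pi * n / L| = 2 * Real.pi * |(n : ℝ)| / L := by
      simp only [abs_div, abs_mul, abs_of_pos hL, abs_of_pos Real.pi_pos, Nat.abs_ofNat]
    rw [hκ] at h1 h2 ⊢
    rw [← sq_abs (n : ℝ)]
    set x := |(n : ℝ)|
    have hx : 0 < x := by linarith
    have hpp : 0 < Real.pi := Real.pi_pos
    set k := 2 * Real.pi * x / L with hk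
    have hk0 : 0 < k := by positivity
    have hk6 : 6 * x / L ≤ k := by rw [hk]; gcongr; linarith
    have e1 : ‖a n‖ * k ≤ c₁ / 36 * (1 / x ^ 2) := by
      have : ‖a n‖ * k * (6 * x / L) ^ 2 ≤ c₁ / L ^ 2 :=
        le_trans (by rw [mul_assoc, pow_succ' k 2]; gcongr) h1
      rw [mul_one_div, le_div_iff₀ (by positivity)]
      have e : ‖a n‖ * k * x ^ 2 = ‖a n‖ * k * (6 * x / L) ^ 2 * (L ^ 2 / 36) := by field_simp; norm_num
      rw [e]
      refine (mul_le_mul_of_nonneg_right this (by positivity)).trans (le_of_eq ?_)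
      field_simp
    have e2 : ‖b n‖ / (ω₀ * L * k) * k ≤ c₂ / (216 * ω₀) * (1 / x ^ 2) := by
      have e3 : ‖b n‖ * (6 * x / L) ^ 3 ≤ c₂ / L ^ 2 := le_trans (by gcongr) h2
      have e4 : ‖b n‖ / (ω₀ * L * k) * k * x ^ 3 =
          ‖b n‖ * (6 * x / L) ^ 3 * (L ^ 2 / (216 * ω₀)) := by field_simp; norm_num
      have e5 : ‖b n‖ / (ω₀ * L * k) * k * x ^ 3 ≤ c₂ / (216 * ω₀) := by
        rw [e4]
        refine (mul_le_mul_of_nonneg_right e3 (by positivity)).trans (le_of_eq ?_)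
        field_simp
      rw [mul_one_div, le_div_iff₀ (by positivity)]
      refine le_trans ?_ e5
      gcongr ?_ * ?_
      exact pow_le_pow_right₀ hn1 (by norm_num)
    calc (‖a n‖ + ‖b n‖ / (ω₀ * L * k)) * k = ‖a n‖ * k + ‖b n‖ / (ω₀ * L * k) * k := by ring
      _ ≤ B * (1 / x ^ 2) := by rw [hB, add_mul]; exact add_le_add e1 e2

/-! ### Consistency of the discretisation -/

/-- Mean value inequality on `[0, h]` for functions that vanish at `0`. -/
theorem abs_le_of_abs_deriv_le {q q' : ℝ → ℝ} {h M : ℝ} (hh : 0 ≤ h) (h0 : q 0 = 0)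
    (hq : ∀ s, HasDerivAt q (q' s) s) (hM : ∀ s ∈ Icc 0 h, |q' s| ≤ M) : |q h| ≤ M * h := by
  have := Convex.norm_image_sub_le_of_norm_hasDerivWithin_le (s := Icc 0 h)
    (fun y _ => (hq y).hasDerivWithinAt) hM (convex_Icc 0 h) (left_mem_Icc.2 hh)
    (right_mem_Icc.2 hh)
  simpa [h0, abs_of_nonneg hh] using this

/-- The mean value inequality is applied twice in the step size. Only a Lipschitz g'' is needed, not
a third derivative. -/
theorem abs_second_difference_le {g g' g'' : ℝ → ℝ} {K : ℝ} (hg : ∀ z, HasDerivAt g (g' z) z)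
    (hg' : ∀ z, HasDerivAt g' (g'' z) z) (hK : ∀ z z', |g'' z - g'' z'| ≤ K * |z - z'|)
    (z : ℝ) {h : ℝ} (hh : 0 ≤ h) :
    |g (z + h) - 2 * g z + g (z - h) - h ^ 2 * g'' z| ≤ 2 * K * h ^ 3 := by
  have hK0 : 0 ≤ K := by simpa using (abs_nonneg _).trans (hK 1 0)
  have ha : ∀ s : ℝ, HasDerivAt (fun s => z + s) 1 s := fun s => (hasDerivAt_id s).const_add z
  have hb : ∀ s : ℝ, HasDerivAt (fun s => z - s) (-1) s := fun s => (hasDerivAt_id s).const_sub z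
  have h2 : ∀ s ∈ Icc 0 h, |g' (z + s) - g' (z - s) - 2 * s * g'' z| ≤ 2 * K * h ^ 2 := by
    intro s hs
    have := abs_le_of_abs_deriv_le (q := fun s => g' (z + s) - g' (z - s) - 2 * s * g'' z)
      (q' := fun s => g'' (z + s) + g'' (z - s) - 2 * g'' z) (M := 2 * K * h) hs.1 (by simp)
      (fun s => by
        have := (((hg' (z + s)).comp s (ha s)).sub ((hg' (z - s)).comp s (hb s))).sub
          (((hasDerivAt_id s).const_mul 2).mul_const (g'' z))
        exact this.congr_deriv (by ring))
      (fun r hr => by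
        have hrh : r ≤ h := hr.2.trans hs.2
        have e1 := hK (z + r) z
        have e2 := hK (z - r) z
        rw [add_sub_cancel_left, abs_of_nonneg hr.1] at e1
        rw [sub_sub_cancel_left, abs_neg, abs_of_nonneg hr.1] at e2
        have e3 := mul_le_mul_of_nonneg_left hrh hK0
        rw [abs_le] at e1 e2 ⊢
        constructor <;> linarith)
    refine this.trans ?_
    calc 2 * K * h * s ≤ 2 * K * h * h := by gcongr; exact hs.2
      _ = 2 * K * h ^ 2 := by ring
  have := abs_le_of_abs_deriv_le (q := fun s => g (z + s) - 2 * g z + g (z - s) - s ^ 2 * g'' z)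
    (q' := fun s => g' (z + s) - g' (z - s) - 2 * s * g'' z) (M := 2 * K * h ^ 2) hh
    (by simp only [add_zero, sub_zero]; ring)
    (fun s => by
      have := ((((hg (z + s)).comp s (ha s)).sub_const (2 * g z)).add
        ((hg (z - s)).comp s (hb s))).sub ((hasDerivAt_pow 2 s).mul_const (g'' z))
      exact this.congr_deriv (by simp; ring)) h2
  exact this.trans (le_of_eq (by ring))

theorem exists_bound_of_periodic {g : ℝ → ℝ} {L : ℝ} (hL : 0 < L) (hg : Continuous g)
    (hp : Function.Periodic g L) : ∃ B, 0 ≤ B ∧ ∀ x, |g x| ≤ B := by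
  obtain ⟨B, hB⟩ := (isCompact_Icc (a := (0 : ℝ)) (b := L)).exists_bound_of_continuousOn
    hg.continuousOn
  refine ⟨B, (norm_nonneg _).trans (hB 0 (left_mem_Icc.2 hL.le)), fun x => ?_⟩
  obtain ⟨y, hy, hxy⟩ := hp.exists_mem_Ico₀ hL x
  rw [hxy]
  exact hB y (Ico_subset_Icc_self hy)

/-- B bounds |g'|, globally by periodicity. With h = L/N this compares the prescribed increments
with those of the primitive. -/
theorem exists_primitive_step_bound {g : ℝ → ℝ} {L : ℝ} (hL : 0 < L) (hg : ContDiff ℝ 4 g)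
    (hp : Function.Periodic g L) : ∃ B, 0 ≤ B ∧ ∀ z h, 0 ≤ h →
      |xOfZ g (z + h) - xOfZ g z - h * g z| ≤ B * h ^ 2 := by
  obtain ⟨B, hB0, hB⟩ := exists_bound_of_periodic hL (hg.continuous_deriv (by norm_num))
    (periodic_deriv hp)
  refine ⟨B, hB0, fun z h hh => ?_⟩
  have hd : ∀ z, HasDerivAt g (deriv g z) z := fun z =>
    (hg.differentiable (by norm_num) z).hasDerivAt
  have ha : ∀ s : ℝ, HasDerivAt (fun s => z + s) 1 s := fun s => (hasDerivAt_id s).const_add z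
  have := abs_le_of_abs_deriv_le (q := fun s => xOfZ g (z + s) - xOfZ g z - s * g z)
    (q' := fun s => g (z + s) - g z) (M := B * h) hh (by simp)
    (fun s => by
      have := (((hasDerivAt_xOfZ hg.continuous (z + s)).comp s (ha s)).sub_const (xOfZ g z)).sub
        ((hasDerivAt_id s).mul_const (g z))
      exact this.congr_deriv (by ring))
    (fun s hs => by
      refine (abs_le_of_abs_deriv_le (q := fun s => g (z + s) - g z)
        (q' := fun s => deriv g (z + s)) (M := B) hs.1 (by simp)
        (fun s => (((hd (z + s)).comp s (ha s)).sub_const (g z)).congr_deriv (by ring))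
        (fun s _ => hB _)).trans ?_
      gcongr
      exact hs.2)
  exact this.trans (le_of_eq (by ring))

/-- Summation of almost smooth increments over one period. -/
theorem almost_smooth_sum {g : ℝ → ℝ} {L B C : ℝ} (hL : 0 < L) (hB0 : 0 ≤ B) (hC : 0 < C)
    (hB : ∀ z h, 0 ≤ h → |xOfZ g (z + h) - xOfZ g z - h * g z| ≤ B * h ^ 2)
    {N : ℕ} (hN : 0 < N) {p : ℤ → ℝ}
    (hp : ∀ k : ℤ, |p (k + 1) - p k - L / N * g (k * L / N)| < C / (N : ℝ) ^ 2) :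
    (∀ k : ℤ, |(p (k + 1) - xOfZ g ((k + 1 : ℤ) * L / N)) - (p k - xOfZ g (k * L / N))| ≤
      (C + B * L ^ 2) / (N : ℝ) ^ 2) ∧
    ∀ k : ℕ, k ≤ N → |p k - xOfZ g (k * L / N) - p 0| ≤ (C + B * L ^ 2) / N := by
  have hN' : (0 : ℝ) < N := by exact_mod_cast hN
  have h1 : ∀ k : ℤ, |(p (k + 1) - xOfZ g ((k + 1 : ℤ) * L / N)) - (p k - xOfZ g (k * L / N))| ≤
      (C + B * L ^ 2) / (N : ℝ) ^ 2 := by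
    intro k
    have e1 := (hp k).le
    have e2 := hB (k * L / N) (L / N) (by positivity)
    rw [show (k : ℝ) * L / N + L / N = (k + 1 : ℤ) * L / N by push_cast; ring] at e2
    have e3 : (C + B * L ^ 2) / (N : ℝ) ^ 2 = C / (N : ℝ) ^ 2 + B * (L / N) ^ 2 := by
      field_simp
    rw [e3]
    rw [abs_le] at e1 e2 ⊢
    constructor <;> linarith
  refine ⟨h1, fun k hk => ?_⟩
  have hD : 0 ≤ (C + B * L ^ 2) / (N : ℝ) ^ 2 := by positivity
  -- Errors of order N⁻² accumulate over at most N steps, which leaves 1/N.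
  have h2 : ∀ k : ℕ, |p k - xOfZ g (k * L / N) - p 0| ≤ k * ((C + B * L ^ 2) / (N : ℝ) ^ 2) := by
    intro k
    induction k with
    | zero => simp [xOfZ]
    | succ k ih =>
      have e1 := h1 k
      push_cast at e1 ih ⊢
      rw [abs_le] at e1 ih ⊢
      constructor <;> linarith
  refine (h2 k).trans ?_
  calc (k : ℝ) * ((C + B * L ^ 2) / (N : ℝ) ^ 2) ≤ N * ((C + B * L ^ 2) / (N : ℝ) ^ 2) := by
        gcongr
    _ = (C + B * L ^ 2) / N := by field_simp

/-! ### Energy estimate and convergence of the chain -/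

theorem exists_range_of_periodic {N : ℕ} (hN : 0 < N) {e : ℤ → ℝ}
    (he : ∀ k, e (k + N) = e k) (k : ℤ) : ∃ j : ℕ, j < N ∧ e k = e j := by
  have hp : Function.Periodic e (N : ℤ) := he
  have hN' : (N : ℤ) ≠ 0 := by positivity
  refine ⟨(k % N).toNat, ?_, ?_⟩
  · have := Int.emod_lt_of_pos k (by positivity : (0 : ℤ) < N)
    have := Int.emod_nonneg k hN'
    omega
  · rw [Int.toNat_of_nonneg (Int.emod_nonneg k hN')]
    conv_lhs => rw [← Int.emod_add_mul_ediv k N]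
    have := (hp.int_mul (k / N)) (k % N)
    rwa [mul_comm, Int.cast_id] at this

/-- Energy estimate for a forced periodic chain. -/
theorem chain_energy_le {ω α R : ℝ} (hα : 0 ≤ α) {N : ℕ} {e e' r : ℤ → ℝ → ℝ}
    (he : ∀ k t, 0 ≤ t → e (k + N) t = e k t) (he' : ∀ k t, 0 ≤ t → e' (k + N) t = e' k t)
    (hd : ∀ k t, 0 ≤ t → HasDerivWithinAt (e k) (e' k t) (Ici 0) t)
    (hd' : ∀ k t, 0 ≤ t → HasDerivWithinAt (e' k)
      (ω ^ 2 * (e (k + 1) t - 2 * e k t + e (k - 1) t) - α * e' k t + r k t) (Ici 0) t)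
    (hr : ∀ k t, 0 ≤ t → |r k t| ≤ R) {t : ℝ} (ht : 0 ≤ t) :
    ∑ k ∈ Finset.range N, (e' k t ^ 2 + ω ^ 2 * (e (k + 1) t - e k t) ^ 2) ≤
      Real.exp t * (∑ k ∈ Finset.range N, (e' k 0 ^ 2 + ω ^ 2 * (e (k + 1) 0 - e k 0) ^ 2) +
        N * R ^ 2) := by
  set E : ℝ → ℝ := fun t =>
    ∑ k ∈ Finset.range N, (e' k t ^ 2 + ω ^ 2 * (e (k + 1) t - e k t) ^ 2) with hE
  set E' : ℝ → ℝ := fun t => ∑ k ∈ Finset.range N, (2 * e' k t * (-α * e' k t + r k t)) with hE'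
  have hEd : ∀ t, 0 ≤ t → HasDerivWithinAt E (E' t) (Ici 0) t := by
    intro t ht
    have h1 : ∀ k ∈ Finset.range N, HasDerivWithinAt
        (fun t => e' k t ^ 2 + ω ^ 2 * (e (k + 1) t - e k t) ^ 2)
        (2 * e' k t * (-α * e' k t + r k t) +
          2 * ω ^ 2 * ((e ((k + 1 : ℕ) : ℤ) t - e (((k + 1 : ℕ) : ℤ) - 1) t) * e' (k + 1 : ℕ) t -
            (e k t - e ((k : ℤ) - 1) t) * e' k t)) (Ici 0) t := by
      intro k _
      have := ((hd' k t ht).pow 2).add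
        (((((hd (k + 1) t ht).sub (hd k t ht)).pow 2)).const_mul (ω ^ 2))
      refine this.congr_deriv ?_
      push_cast
      simp only [add_sub_cancel_right, Pi.sub_apply, pow_one]
      ring
    have h2 := HasDerivWithinAt.fun_sum h1
    refine h2.congr_deriv ?_
    -- The coupling terms telescope, and the boundary terms agree because e and e' have period N in
    -- k.
    rw [Finset.sum_add_distrib, ← Finset.mul_sum,
      Finset.sum_range_sub (fun k : ℕ => (e k t - e ((k : ℤ) - 1) t) * e' k t) N]
    have e1 := he 0 t ht
    have e2 := he (-1) t ht
    have e3 := he' 0 t ht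
    rw [zero_add] at e1 e3
    rw [neg_add_eq_sub] at e2
    simp [e1, e2, e3, E']
  -- The damping term is nonpositive and 2e'r ≤ e'² + r².
  have hEbound : ∀ t, 0 ≤ t → E' t ≤ E t + N * R ^ 2 := by
    intro t ht
    have : (N : ℝ) * R ^ 2 = ∑ _k ∈ Finset.range N, R ^ 2 := by simp
    rw [this, ← Finset.sum_add_distrib]
    refine Finset.sum_le_sum fun k _ => ?_
    have h1 : r k t ^ 2 ≤ R ^ 2 := sq_le_sq' (abs_le.1 (hr k t ht)).1 (abs_le.1 (hr k t ht)).2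
    have h2 : 0 ≤ ω ^ 2 * (e (k + 1) t - e k t) ^ 2 := by positivity
    have h3 : 0 ≤ α * e' k t ^ 2 := by positivity
    nlinarith [sq_nonneg (e' k t - r k t)]
  -- Grönwall's inequality with rate 1.
  have hanti : AntitoneOn (fun t => Real.exp (-t) * (E t + N * R ^ 2)) (Ici 0) := by
    have hF : ∀ t, 0 ≤ t → HasDerivWithinAt (fun t => Real.exp (-t) * (E t + N * R ^ 2))
        (Real.exp (-t) * (E' t - (E t + N * R ^ 2))) (Ici 0) t := by
      intro t ht
      have := ((hasDerivAt_neg t).exp.hasDerivWithinAt (s := Ici 0)).mul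
        ((hEd t ht).add_const (N * R ^ 2))
      exact this.congr_deriv (by ring)
    refine antitoneOn_of_hasDerivWithinAt_nonpos (convex_Ici 0)
      (f' := fun t => Real.exp (-t) * (E' t - (E t + N * R ^ 2)))
      (fun t ht => (hF t ht).continuousWithinAt)
      (fun t ht => (hF t (interior_subset ht)).mono interior_subset)
      (fun t ht => ?_)
    have h1 := hEbound t (interior_subset ht)
    exact mul_nonpos_of_nonneg_of_nonpos (Real.exp_pos _).le (by linarith)
  have := hanti (mem_Ici.2 le_rfl) (mem_Ici.2 ht) ht
  simp only [neg_zero, Real.exp_zero, one_mul] at this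
  have h1 : E t + N * R ^ 2 ≤ Real.exp t * (E 0 + N * R ^ 2) := by
    calc E t + N * R ^ 2 = Real.exp t * (Real.exp (-t) * (E t + N * R ^ 2)) := by
          rw [← mul_assoc, ← Real.exp_add]; simp
      _ ≤ _ := by gcongr
  have h2 : 0 ≤ (N : ℝ) * R ^ 2 := by positivity
  linarith

theorem IsChainTrajectory.vel_periodic {L ω α : ℝ} {f : ℝ → ℝ} {N : ℕ} {x w : ℤ → ℝ → ℝ}
    (h : IsChainTrajectory L ω α f N x w) (k : ℤ) {t : ℝ} (ht : 0 ≤ t) : w (k + N) t = w k t := by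
  have h1 : HasDerivWithinAt (x (k + N)) (w k t) (Ici 0) t :=
    ((h.hasDeriv_pos k t ht).add_const L).congr (fun s hs => h.periodic k s hs)
      (h.periodic k t ht)
  exact (uniqueDiffOn_Ici 0 t ht).eq_deriv _ (h.hasDeriv_pos _ t ht) h1

theorem IsStringMotion.deriv_t_periodic {L c α : ℝ} {f : ℝ → ℝ}
    {g g_t g_z g_tt g_tz g_zz : ℝ → ℝ → ℝ} (h : IsStringMotion L c α f g g_t g_z g_tt g_tz g_zz)
    {t : ℝ} (ht : -1 < t) (z : ℝ) : g_t t (z + L) = g_t t z := by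
  have h1 : HasDerivAt (fun s => g s (z + L)) (g_t t z) t :=
    ((h.deriv_t t z ht).add_const L).congr_of_eventuallyEq <| by
      filter_upwards [Ioi_mem_nhds ht] with s hs using h.add_period s z hs
  exact (h.deriv_t t (z + L) ht).unique h1

theorem IsStringMotion.deriv_z_periodic {L c α : ℝ} {f : ℝ → ℝ}
    {g g_t g_z g_tt g_tz g_zz : ℝ → ℝ → ℝ} (h : IsStringMotion L c α f g g_t g_z g_tt g_tz g_zz)
    {t : ℝ} (ht : -1 < t) (z : ℝ) : g_z t (z + L) = g_z t z := by
  have h1 : HasDerivAt (fun s => g t (s + L)) (g_z t z) z :=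
    ((h.deriv_z t z ht).add_const L).congr_of_eventuallyEq <|
      Eventually.of_forall fun s => h.add_period t s ht
  exact ((h.deriv_z t (z + L) ht).comp_add_const z L).unique h1

/-- Distance between the chain of `N` particles and the motion of the string. -/
theorem exists_chain_dist_le {L ω₀ α : ℝ} (hL : 0 < L) (hα : 0 ≤ α)
    {f : ℝ → ℝ} {X V : ℝ → ℝ} (hXV : IsProfile L X V)
    {C₁ C₂ : ℝ} (hC₁ : 0 < C₁) (hC₂ : 0 < C₂) {v : ℝ}
    {g g_t g_z g_tt g_tz g_zz : ℝ → ℝ → ℝ}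
    (hg : IsStringMotion L (ω₀ * L) α f g g_t g_z g_tt g_tz g_zz)
    (hg0 : ∀ z, g 0 z = xOfZ X z) (hgt0 : ∀ z, g_t 0 z = v + xOfZ V z) :
    ∃ D K : ℝ, ∀ (N : ℕ) (x w : ℤ → ℝ → ℝ), 0 < N → IsChainTrajectory L (ω₀ * N) α f N x w →
      IsAlmostSmooth L X V C₁ C₂ N (fun k => x k 0) (fun k => w k 0) → w 0 0 = v →
      ∀ k t, 0 ≤ t → |x k t - g t (k * L / N)| ≤ D / N + √(Real.exp t * (K / N)) * t := by
  obtain ⟨K, hK0, hK⟩ := hg.lipschitz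
  obtain ⟨B₁, hB₁0, hB₁⟩ := exists_primitive_step_bound hL hXV.contDiff_X hXV.periodic_X
  obtain ⟨B₂, hB₂0, hB₂⟩ := exists_primitive_step_bound hL hXV.contDiff_V hXV.periodic_V
  set D₁ := C₁ + B₁ * L ^ 2 with hD₁
  set D₂ := C₂ + B₂ * L ^ 2 with hD₂
  refine ⟨D₁, D₂ ^ 2 + ω₀ ^ 2 * D₁ ^ 2 + (2 * K * ω₀ ^ 2 * L ^ 3) ^ 2, ?_⟩
  intro N x w hN hx hs hw0
  -- The summands come from the initial velocities, the initial gaps and the consistency error.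
  set K₁ := D₂ ^ 2 + ω₀ ^ 2 * D₁ ^ 2 + (2 * K * ω₀ ^ 2 * L ^ 3) ^ 2 with hK₁
  have hN' : (0 : ℝ) < N := by exact_mod_cast hN
  have hneg : ∀ t : ℝ, 0 ≤ t → -1 < t := fun t ht => by linarith
  obtain ⟨hx1, hx2⟩ := almost_smooth_sum hL hB₁0 hC₁ hB₁ hN
    (p := fun k => x k 0) hs.gap
  obtain ⟨hw1, hw2⟩ := almost_smooth_sum hL hB₂0 hC₂ hB₂ hN
    (p := fun k => w k 0) hs.vel
  have hshift : ∀ k : ℤ, ((k + N : ℤ) : ℝ) * L / N = k * L / N + L := fun k => by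
    push_cast; field_simp
  have hsucc : ∀ k : ℤ, ((k + 1 : ℤ) : ℝ) * L / N = k * L / N + L / N := fun k => by
    push_cast; ring
  have hpred : ∀ k : ℤ, ((k - 1 : ℤ) : ℝ) * L / N = k * L / N - L / N := fun k => by
    push_cast; ring
  set e : ℤ → ℝ → ℝ := fun k t => x k t - g t (k * L / N) with he
  set e' : ℤ → ℝ → ℝ := fun k t => w k t - g_t t (k * L / N) with he'
  -- The consistency error: (ω₀N)² times second difference, minus (ω₀L)² g_zz. The difference is
  -- O(N⁻³), so r is O(1/N).
  set r : ℤ → ℝ → ℝ := fun k t => (ω₀ * N) ^ 2 * (g t (k * L / N + L / N) - 2 * g t (k * L / N) +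
    g t (k * L / N - L / N) - (L / N) ^ 2 * g_zz t (k * L / N)) with hr
  have hep : ∀ k t, 0 ≤ t → e (k + N) t = e k t := fun k t ht => by
    simp only [he, hshift]
    rw [hx.periodic k t ht, hg.add_period t _ (hneg t ht)]
    ring
  have he'p : ∀ k t, 0 ≤ t → e' (k + N) t = e' k t := fun k t ht => by
    simp only [he', hshift]
    rw [hx.vel_periodic k ht, hg.deriv_t_periodic (hneg t ht)]
  have hed : ∀ k t, 0 ≤ t → HasDerivWithinAt (e k) (e' k t) (Ici 0) t := fun k t ht =>
    (hx.hasDeriv_pos k t ht).sub (hg.deriv_t t _ (hneg t ht)).hasDerivWithinAt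
  have he'd : ∀ k t, 0 ≤ t → HasDerivWithinAt (e' k)
      ((ω₀ * N) ^ 2 * (e (k + 1) t - 2 * e k t + e (k - 1) t) - α * e' k t + r k t) (Ici 0) t := by
    intro k t ht
    have := (hx.hasDeriv_vel k t ht).sub
      (hg.deriv_tt t (k * L / N) (hneg t ht)).hasDerivWithinAt
    refine this.congr_deriv ?_
    rw [hg.eqn t _ (hneg t ht)]
    simp only [he, he', hr, hsucc, hpred]
    field_simp
    ring
  have hrb : ∀ k t, 0 ≤ t → |r k t| ≤ 2 * K * ω₀ ^ 2 * L ^ 3 / N := by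
    intro k t ht
    have := abs_second_difference_le (fun z => hg.deriv_z t z (hneg t ht))
      (fun z => hg.deriv_zz t z (hneg t ht)) (fun z z' => hK t z z' (hneg t ht)) (k * L / N)
      (h := L / N) (by positivity)
    simp only [hr]
    rw [abs_mul, abs_of_nonneg (by positivity : 0 ≤ (ω₀ * N) ^ 2)]
    refine (mul_le_mul_of_nonneg_left this (by positivity)).trans (le_of_eq ?_)
    field_simp
  have he0 : ∀ k, |e k 0| ≤ D₁ / N := by
    intro k
    obtain ⟨j, hj, hkj⟩ := exists_range_of_periodic hN (e := fun k => e k 0)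
      (fun k => hep k 0 le_rfl) k
    have := hx2 j hj.le
    simp only [hs.zero, sub_zero] at this
    rw [hkj]
    simpa only [he, hg0, Int.cast_natCast] using this
  have he'0 : ∀ k : ℕ, k < N → |e' k 0| ≤ D₂ / N := by
    intro k hk
    have := hw2 k hk.le
    rw [hw0, sub_right_comm, sub_sub] at this
    simpa only [he', hgt0, Int.cast_natCast] using this
  have hde0 : ∀ k, |e (k + 1) 0 - e k 0| ≤ D₁ / N ^ 2 := by
    intro k
    simpa only [he, hg0] using hx1 k
  -- The error gaps are O(N⁻²), which compensates the factor N² in the elastic energy; each of the N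
  -- terms is O(N⁻²).
  have hE0 : ∑ k ∈ Finset.range N, (e' k 0 ^ 2 + (ω₀ * N) ^ 2 * (e (k + 1) 0 - e k 0) ^ 2) ≤
      (D₂ ^ 2 + ω₀ ^ 2 * D₁ ^ 2) / N := by
    have : ∀ k ∈ Finset.range N, e' k 0 ^ 2 + (ω₀ * N) ^ 2 * (e (k + 1) 0 - e k 0) ^ 2 ≤
        (D₂ ^ 2 + ω₀ ^ 2 * D₁ ^ 2) / N ^ 2 := by
      intro k hk
      have h1 := he'0 k (Finset.mem_range.1 hk)
      have h2 := hde0 k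
      calc e' k 0 ^ 2 + (ω₀ * N) ^ 2 * (e (k + 1) 0 - e k 0) ^ 2
          ≤ (D₂ / N) ^ 2 + (ω₀ * N) ^ 2 * (D₁ / N ^ 2) ^ 2 := by
            rw [← sq_abs (e' k 0), ← sq_abs (e (k + 1) 0 - e k 0)]
            gcongr
        _ = _ := by field_simp
    refine (Finset.sum_le_sum this).trans (le_of_eq ?_)
    rw [Finset.sum_const, Finset.card_range, nsmul_eq_mul]
    field_simp
  -- A single velocity error is at most the root of the whole energy; integrating it in time bounds
  -- the position error.
  have hvel : ∀ k t, 0 ≤ t → |e' k t| ≤ √(Real.exp t * (K₁ / N)) := by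
    intro k t ht
    obtain ⟨j, hj, hkj⟩ := exists_range_of_periodic hN (e := fun k => e' k t)
      (fun k => he'p k t ht) k
    rw [hkj]
    refine Real.abs_le_sqrt ?_
    have h1 := chain_energy_le hα hep he'p hed he'd hrb ht
    have h2 : e' j t ^ 2 ≤
        ∑ k ∈ Finset.range N, (e' k t ^ 2 + (ω₀ * N) ^ 2 * (e (k + 1) t - e k t) ^ 2) := by
      refine le_trans ?_ (Finset.single_le_sum
        (f := fun k : ℕ => e' k t ^ 2 + (ω₀ * N) ^ 2 * (e (k + 1) t - e k t) ^ 2)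
        (fun k _ => by positivity) (Finset.mem_range.2 hj))
      have : 0 ≤ (ω₀ * N) ^ 2 * (e (j + 1) t - e j t) ^ 2 := by positivity
      linarith
    refine (h2.trans h1).trans (mul_le_mul_of_nonneg_left ?_ (Real.exp_pos t).le)
    have h3 : K₁ / N = (D₂ ^ 2 + ω₀ ^ 2 * D₁ ^ 2) / N + N * (2 * K * ω₀ ^ 2 * L ^ 3 / N) ^ 2 := by
      rw [hK₁]; field_simp
    rw [h3]
    gcongr
  intro k t ht
  have h1 := Convex.norm_image_sub_le_of_norm_hasDerivWithin_le (f := e k) (s := Icc 0 t)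
    (C := √(Real.exp t * (K₁ / N)))
    (fun y hy => (hed k y hy.1).mono Icc_subset_Ici_self)
    (fun y hy => (hvel k y hy.1).trans (Real.sqrt_le_sqrt (by
      have : 0 ≤ K₁ / N := by positivity
      gcongr
      exact hy.2)))
    (convex_Icc 0 t) (left_mem_Icc.2 ht) (right_mem_Icc.2 ht)
  rw [Real.norm_eq_abs, Real.norm_eq_abs, sub_zero, abs_of_nonneg ht] at h1
  have h2 := abs_sub_abs_le_abs_sub (e k t) (e k 0)
  have h3 := he0 k
  change |e k t| ≤ _
  linarith

/-- Uniform convergence of the chains to the motion of the string at each time. -/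
theorem chain_tendstoUniformly {L ω₀ α : ℝ} (hL : 0 < L) (hα : 0 ≤ α)
    {f : ℝ → ℝ} {X V : ℝ → ℝ} (hXV : IsProfile L X V)
    {C₁ C₂ : ℝ} (hC₁ : 0 < C₁) (hC₂ : 0 < C₂) {v : ℝ}
    {g g_t g_z g_tt g_tz g_zz : ℝ → ℝ → ℝ}
    (hg : IsStringMotion L (ω₀ * L) α f g g_t g_z g_tt g_tz g_zz)
    (hg0 : ∀ z, g 0 z = xOfZ X z) (hgt0 : ∀ z, g_t 0 z = v + xOfZ V z)
    {x w : ℕ → ℤ → ℝ → ℝ}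
    (hdyn : ∀ᶠ N : ℕ in atTop, IsChainTrajectory L (ω₀ * N) α f N (x N) (w N))
    (hinit : ∀ᶠ N : ℕ in atTop,
      IsAlmostSmooth L X V C₁ C₂ N (fun k => x N k 0) (fun k => w N k 0))
    (hv : ∀ᶠ N : ℕ in atTop, w N 0 0 = v) {t : ℝ} (ht : 0 ≤ t) {ε : ℝ} (hε : 0 < ε) :
    ∀ᶠ N : ℕ in atTop, ∀ k : ℤ, |x N k t - g t (k * L / N)| < ε := by
  obtain ⟨D, K, h⟩ := exists_chain_dist_le hL hα hXV hC₁ hC₂ hg hg0 hgt0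
  have hlim : Tendsto (fun N : ℕ => D / (N : ℝ) + √(Real.exp t * (K / N)) * t) atTop (𝓝 0) := by
    have h1 := tendsto_const_div_atTop_nhds_zero_nat D
    have h2 := (tendsto_const_div_atTop_nhds_zero_nat K).const_mul (Real.exp t)
    have h3 := h1.add (((Real.continuous_sqrt.tendsto _).comp h2).mul_const t)
    simpa using h3
  filter_upwards [hdyn, hinit, hv, hlim.eventually (gt_mem_nhds hε), eventually_gt_atTop 0]
    with N h1 h2 h3 h4 h5 k
  exact (h N (x N) (w N) h5 h1 h2 h3 k t ht).trans_lt h4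

/-! ### Inverse of the motion and counting of labels -/

/-- `Z` is the inverse of the lift `h` of a circle diffeomorphism with `h' ≥ m > 0`. -/
structure IsLiftInverse (L m : ℝ) (h h' Z : ℝ → ℝ) : Prop where
  left_inv : ∀ z, Z (h z) = z
  right_inv : ∀ y, h (Z y) = y
  mono : StrictMono Z
  lipschitz : ∀ y y', |Z y - Z y'| ≤ |y - y'| / m
  add_zsmul : ∀ y (k : ℤ), Z (y + k * L) = Z y + k * L
  hasDerivAt : ∀ y, HasDerivAt Z (h' (Z y))⁻¹ y

theorem exists_isLiftInverse {L m : ℝ} (hm : 0 < m) {h h' : ℝ → ℝ}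
    (hd : ∀ z, HasDerivAt h (h' z) z) (hp : ∀ z, h (z + L) = h z + L) (hm' : ∀ z, m ≤ h' z) :
    ∃ Z, IsLiftInverse L m h h' Z := by
  have hdiff : Differentiable ℝ h := fun z => (hd z).differentiableAt
  have hlow : ∀ z z', z ≤ z' → m * (z' - z) ≤ h z' - h z := fun z z' hz =>
    mul_sub_le_image_sub_of_le_deriv hdiff (fun z => by rw [(hd z).deriv]; exact hm' z) hz
  have hmono : StrictMono h := fun z z' hz => by
    have := hlow z z' hz.le
    have := mul_pos hm (sub_pos.2 hz)
    linarith
  have htop : Tendsto h atTop atTop := by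
    refine tendsto_atTop_mono' atTop (f₁ := fun z => h 0 + m * z) ?_
      (tendsto_atTop_add_const_left _ _ (tendsto_id.const_mul_atTop hm))
    filter_upwards [eventually_ge_atTop 0] with z hz
    have := hlow 0 z hz
    rw [sub_zero] at this
    linarith
  have hbot : Tendsto h atBot atBot := by
    refine tendsto_atBot_mono' atBot (f₁ := fun z => h 0 + m * z) ?_
      (tendsto_atBot_add_const_left _ _ (tendsto_id.const_mul_atBot hm))
    filter_upwards [eventually_le_atBot 0] with z hz
    have := hlow z 0 hz
    rw [zero_sub] at this
    linarith
  set o := hmono.orderIsoOfSurjective h (hdiff.continuous.surjective htop hbot) with ho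
  have hl : ∀ z, o.symm (h z) = z := fun z => o.symm_apply_apply z
  have hr : ∀ y, h (o.symm y) = y := fun y => o.apply_symm_apply y
  have hp' : ∀ z (k : ℤ), h (z + k * L) = h z + k * L := by
    have : Function.Periodic (fun z => h z - z) L := fun z => by simp only [hp]; ring
    intro z k
    have := this.int_mul k z
    linarith
  refine ⟨o.symm, hl, hr, o.symm.strictMono, fun y y' => ?_, fun y k => ?_, fun y => ?_⟩
  · rw [le_div_iff₀ hm]
    wlog hy : y ≤ y' generalizing y y'
    · rw [abs_sub_comm, abs_sub_comm y]
      exact this y' y (le_of_not_ge hy)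
    · have h1 := hlow _ _ (o.symm.monotone hy)
      rw [hr, hr] at h1
      rw [abs_sub_comm, abs_of_nonneg (sub_nonneg.2 (o.symm.monotone hy)), abs_sub_comm,
        abs_of_nonneg (sub_nonneg.2 hy)]
      linarith
  · rw [← hl (o.symm y + k * L), hp', hr]
  · exact HasDerivAt.of_local_left_inverse o.symm.continuous.continuousAt (hd _)
      (hm.trans_le (hm' _)).ne' (Eventually.of_forall hr)

/-- At most `B - A + 1` classes modulo `N` have a representative in `[A, B]`. -/
theorem card_filter_range_le {N : ℕ} {A B : ℝ} (hAB : A ≤ B) (P : ℕ → Prop)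
    [DecidablePred P] (hP : ∀ k < N, P k → ∃ j : ℤ, A ≤ k - j * N ∧ k - j * N ≤ B) :
    (((Finset.range N).filter P).card : ℝ) ≤ B - A + 1 := by
  -- The integer k - jN lies in [A, B], and its residue modulo N recovers k < N.
  have hsub : (Finset.range N).filter P ⊆
      (Finset.Icc ⌈A⌉ ⌊B⌋).image fun j : ℤ => (j % N).toNat := by
    intro k hk
    obtain ⟨hk, hPk⟩ := Finset.mem_filter.1 hk
    have hk := Finset.mem_range.1 hk
    obtain ⟨j, h1, h2⟩ := hP k hk hPk
    refine Finset.mem_image.2 ⟨k - j * N, Finset.mem_Icc.2 ⟨Int.ceil_le.2 (by exact_mod_cast h1),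
      Int.le_floor.2 (by exact_mod_cast h2)⟩, ?_⟩
    rw [Int.sub_mul_emod_self_right, Int.emod_eq_of_lt (by positivity) (by exact_mod_cast hk)]
    simp
  have hcard := (Finset.card_le_card hsub).trans Finset.card_image_le
  rw [Int.card_Icc] at hcard
  have h1 := Int.floor_le B
  have h2 := Int.le_ceil A
  have h3 : (((⌊B⌋ + 1 - ⌈A⌉).toNat : ℤ) : ℝ) ≤ B - A + 1 := by
    rcases le_total 0 (⌊B⌋ + 1 - ⌈A⌉) with h | h
    · rw [Int.toNat_of_nonneg h]
      push_cast
      linarith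
    · rw [Int.toNat_of_nonpos h]
      push_cast
      linarith
  refine le_trans ?_ h3
  exact_mod_cast hcard

section Limits

variable {L m : ℝ} {h h' Z : ℝ → ℝ}

theorem IsLiftInverse.le_add (hZ : IsLiftInverse L m h h' Z) {y ε : ℝ} (hε : 0 ≤ ε) :
    Z (y + ε) ≤ Z y + ε / m := by
  have := (abs_le.1 (hZ.lipschitz (y + ε) y)).2
  rw [add_sub_cancel_left, abs_of_nonneg hε] at this
  linarith

theorem IsLiftInverse.sub_le (hZ : IsLiftInverse L m h h' Z) {y ε : ℝ} (hε : 0 ≤ ε) :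
    Z y - ε / m ≤ Z (y - ε) := by
  have := (abs_le.1 (hZ.lipschitz y (y - ε))).2
  rw [sub_sub_cancel, abs_of_nonneg hε] at this
  linarith

theorem IsLiftInverse.le_iff (hZ : IsLiftInverse L m h h' Z) {y z : ℝ} : y ≤ h z ↔ Z y ≤ z := by
  rw [← hZ.mono.le_iff_le, hZ.left_inv]

theorem IsLiftInverse.ge_iff (hZ : IsLiftInverse L m h h' Z) {y z : ℝ} : h z ≤ y ↔ z ≤ Z y := by
  rw [← hZ.mono.le_iff_le, hZ.left_inv]

/-- Upper bound for the number of particles of a chain near `h` in an arc of the circle. -/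
theorem card_arc_le (hL : 0 < L) (hm : 0 < m) (hZ : IsLiftInverse L m h h' Z) {N : ℕ} (hN : 0 < N)
    {ε a b : ℝ} (hε : 0 < ε) (hab : a ≤ b) {p : ℤ → ℝ}
    (hp : ∀ k : ℤ, |p k - h (k * L / N)| < ε) (P : ℕ → Prop) [DecidablePred P]
    (hP : ∀ k : ℕ, P k → ∃ j : ℤ, a ≤ p k - j * L ∧ p k - j * L ≤ b) :
    (((Finset.range N).filter P).card : ℝ) ≤ (Z b - Z a + 2 * (ε / m)) * (N / L) + 1 := by
  have hN' : (0 : ℝ) < N := by exact_mod_cast hN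
  have hab' := hZ.mono.monotone hab
  have hεm : 0 < ε / m := by positivity
  -- A position in [a, b] known up to ε has its label in [Z a - ε/m, Z b + ε/m]; the factor N/L
  -- turns labels into indices.
  have := card_filter_range_le (N := N) (A := (Z a - ε / m) * (N / L)) (B := (Z b + ε / m) * (N / L))
    (by gcongr; linarith) P ?_
  · linarith
  intro k _ hk
  obtain ⟨j, h1, h2⟩ := hP k hk
  have h3 := abs_lt.1 (hp k)
  have h4 : a - ε + j * L ≤ h ((k : ℤ) * L / N) := by linarith
  have h5 : h ((k : ℤ) * L / N) ≤ b + ε + j * L := by linarith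
  rw [hZ.le_iff, hZ.add_zsmul] at h4
  rw [hZ.ge_iff, hZ.add_zsmul] at h5
  have h6 := hZ.sub_le (y := a) hε.le
  have h7 := hZ.le_add (y := b) hε.le
  have e : (k : ℝ) - j * N = ((k : ℤ) * L / N - j * L) * (N / L) := by
    push_cast; field_simp
  refine ⟨j, ?_, ?_⟩
  · rw [e]; exact mul_le_mul_of_nonneg_right (by linarith) (by positivity)
  · rw [e]; exact mul_le_mul_of_nonneg_right (by linarith) (by positivity)

theorem empirical_tendsto (hL : 0 < L) (hm : 0 < m) (hZ : IsLiftInverse L m h h' Z)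
    {x : ℕ → ℤ → ℝ → ℝ} {t : ℝ}
    (hx : ∀ ε > 0, ∀ᶠ N : ℕ in atTop, ∀ k : ℤ, |x N k t - h (k * L / N)| < ε)
    {y : ℝ} (hy : y ∈ Ico 0 L) :
    Tendsto (fun N : ℕ => empiricalF hL x N t y) atTop (𝓝 ((Z y - Z 0) / L)) := by
  rw [Metric.tendsto_atTop']
  suffices H : ∀ η > 0, ∀ᶠ N : ℕ in atTop, dist (empiricalF hL x N t y) ((Z y - Z 0) / L) < η by
    intro η hη
    obtain ⟨N, hN⟩ := eventually_atTop.1 (H η hη)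
    exact ⟨N, fun n hn => hN n hn.le⟩
  intro η hη
  -- Makes the label error 2(ε/m)/L equal to η/2; the other half of η absorbs the extra 1/N of the
  -- count.
  set ε := η * m * L / 4 with hεdef
  have hε : 0 < ε := by positivity
  have h1 : ∀ᶠ N : ℕ in atTop, 1 / (N : ℝ) < η / 2 :=
    (tendsto_const_div_atTop_nhds_zero_nat 1).eventually (gt_mem_nhds (by positivity))
  filter_upwards [hx ε hε, h1, eventually_gt_atTop 0] with N hN h1 hN0
  have hN' : (0 : ℝ) < N := by exact_mod_cast hN0
  have hmod : ∀ k : ℕ, x N k t - toIcoDiv hL 0 (x N k t) * L = toIcoMod hL 0 (x N k t) := by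
    intro k
    have := self_sub_toIcoDiv_zsmul hL 0 (x N k t)
    rwa [zsmul_eq_mul] at this
  have hmem : ∀ k : ℕ, toIcoMod hL 0 (x N k t) ∈ Ico 0 L := fun k => toIcoMod_mem_Ico' hL _
  set S := ((Finset.range N).filter fun k : ℕ => toIcoMod hL 0 (x N (k : ℤ) t) ≤ y).card with hS
  have hup : (S : ℝ) ≤ (Z y - Z 0 + 2 * (ε / m)) * (N / L) + 1 :=
    card_arc_le hL hm hZ hN0 hε hy.1 (p := fun k => x N k t) hN _ fun k hk =>
      ⟨_, by rw [hmod]; exact (hmem k).1, by rw [hmod]; exact hk⟩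
  have hZL : Z L = Z 0 + L := by simpa using hZ.add_zsmul 0 1
  -- The lower bound for S is the upper bound for the complementary arc [y, L], whose label length
  -- is L - (Z y - Z 0).
  have hlow := card_arc_le hL hm hZ hN0 hε hy.2.le (p := fun k => x N k t) hN
    (fun k : ℕ => ¬ toIcoMod hL 0 (x N (k : ℤ) t) ≤ y) fun k hk =>
      ⟨_, by rw [hmod]; exact (not_le.1 hk).le, by rw [hmod]; exact (hmem k).2.le⟩
  have hadd : (S : ℝ) +
      (((Finset.range N).filter fun k : ℕ => ¬ toIcoMod hL 0 (x N (k : ℤ) t) ≤ y).card : ℝ) = N := by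
    have := Finset.card_filter_add_card_filter_not (s := Finset.range N)
      (fun k : ℕ => toIcoMod hL 0 (x N (k : ℤ) t) ≤ y)
    rw [Finset.card_range] at this
    exact_mod_cast this
  have e1 : 2 * (ε / m) * (N / L) = η / 2 * N := by rw [hεdef]; field_simp; norm_num
  have e2 : L * (N / L) = N := by field_simp
  have e3 : 1 < η / 2 * N := by rwa [div_lt_iff₀ hN'] at h1
  rw [hZL] at hlow
  have e4 : (Z y - Z 0) * (N / L) = (Z y - Z 0) / L * N := by ring
  rw [Real.dist_eq, abs_lt]
  change -η < (S : ℝ) / N - _ ∧ (S : ℝ) / N - _ < η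
  have e5 : (S : ℝ) = (S : ℝ) / N * N := by field_simp
  constructor
  · have : (-η) * N < ((S : ℝ) / N - (Z y - Z 0) / L) * N := by rw [sub_mul, ← e5]; linarith
    exact lt_of_mul_lt_mul_right this hN'.le
  · have : ((S : ℝ) / N - (Z y - Z 0) / L) * N < η * N := by rw [sub_mul, ← e5]; linarith
    exact lt_of_mul_lt_mul_right this hN'.le

/-- The particles associated with `a` converge to the particle of the string with label `Z a`. -/
theorem particleIndex_tendsto (hL : 0 < L) (hm : 0 < m) (hZ : IsLiftInverse L m h h' Z)
    {p : ℕ → ℤ → ℝ}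
    (hp : ∀ ε > 0, ∀ᶠ N : ℕ in atTop, ∀ k : ℤ, |p N k - h (k * L / N)| < ε) (a : ℝ) :
    Tendsto (fun N : ℕ => (particleIndex (p N) a : ℝ) * L / N) atTop (𝓝 (Z a)) := by
  rw [Metric.tendsto_atTop']
  suffices H : ∀ η > 0, ∀ᶠ N : ℕ in atTop,
      dist ((particleIndex (p N) a : ℝ) * L / N) (Z a) < η by
    intro η hη
    obtain ⟨N, hN⟩ := eventually_atTop.1 (H η hη)
    exact ⟨N, fun n hn => hN n hn.le⟩
  intro η hη
  -- Half of η covers ε/m, the other half the spacing L/N between the labels k and k + 1.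
  set ε := η * m / 2 with hεdef
  have hε : 0 < ε := by positivity
  have h1 : ∀ᶠ N : ℕ in atTop, L / (N : ℝ) < η / 2 :=
    (tendsto_const_div_atTop_nhds_zero_nat L).eventually (gt_mem_nhds (by positivity))
  filter_upwards [hp ε hε, h1, eventually_gt_atTop 0] with N hN h1 hN0
  have hN' : (0 : ℝ) < N := by exact_mod_cast hN0
  -- The greatest k with p k ≤ a exists because p stays within ε of the increasing, unbounded h.
  have hex : ∃ k : ℤ, p N k ≤ a ∧ a < p N (k + 1) := by
    obtain ⟨k, hk, hmax⟩ := Int.exists_greatest_of_bdd (P := fun k => p N k ≤ a)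
      ⟨⌈Z (a + ε) * N / L⌉, fun k hk => by
        have h2 := abs_lt.1 (hN k)
        have h3 : h (k * L / N) ≤ a + ε := by linarith
        rw [hZ.ge_iff, div_le_iff₀ hN', ← le_div_iff₀ hL] at h3
        exact_mod_cast h3.trans (Int.le_ceil _)⟩
      ⟨⌊Z (a - ε) * N / L⌋, by
        have h2 := abs_lt.1 (hN ⌊Z (a - ε) * N / L⌋)
        have h3 := Int.floor_le (Z (a - ε) * N / L)
        rw [le_div_iff₀ hL, ← div_le_iff₀ hN', ← hZ.ge_iff] at h3
        linarith⟩
    refine ⟨k, hk, not_le.1 fun hc => ?_⟩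
    have := hmax _ hc
    omega
  have hspec : p N (particleIndex (p N) a) ≤ a ∧ a < p N (particleIndex (p N) a + 1) :=
    Classical.epsilon_spec hex
  set k := particleIndex (p N) a
  have h2 := abs_lt.1 (hN k)
  have h3 := abs_lt.1 (hN (k + 1))
  have h4 : h (k * L / N) ≤ a + ε := by linarith
  have h5 : a - ε ≤ h ((k + 1 : ℤ) * L / N) := by linarith
  rw [hZ.ge_iff] at h4
  rw [hZ.le_iff] at h5
  have h6 := hZ.le_add (y := a) hε.le
  have h7 := hZ.sub_le (y := a) hε.le
  have e1 : ε / m = η / 2 := by rw [hεdef]; field_simp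
  have e2 : ((k + 1 : ℤ) : ℝ) * L / N = k * L / N + L / N := by push_cast; ring
  rw [e1] at h6 h7
  rw [e2] at h5
  rw [Real.dist_eq, abs_lt]
  constructor <;> linarith

end Limits

/-! ### Continuum limit and density -/

section Continuum

variable {L c α : ℝ} {f : ℝ → ℝ} {X : ℝ → ℝ} {x : ℕ → ℤ → ℝ → ℝ}
  {g g_t g_z g_tt g_tz g_zz : ℝ → ℝ → ℝ} {m : ℝ}

theorem tracer_tendsto (hL : 0 < L) (hm : 0 < m)
    (hx : ∀ t, 0 ≤ t → ∀ ε > 0, ∀ᶠ N : ℕ in atTop, ∀ k : ℤ, |x N k t - g t (k * L / N)| < ε)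
    {Z₀ h' : ℝ → ℝ} (hZ₀ : IsLiftInverse L m (g 0) h' Z₀)
    {t : ℝ} (ht : 0 ≤ t) (hg : Continuous (g t)) (a : ℝ) :
    Tendsto (fun N : ℕ => tracer x N t a) atTop (𝓝 (g t (Z₀ a))) := by
  have h1 := particleIndex_tendsto hL hm hZ₀ (p := fun N k => x N k 0) (hx 0 le_rfl) a
  have h2 := (hg.tendsto _).comp h1
  have h3 : Tendsto (fun N : ℕ => tracer x N t a -
      g t (particleIndex (fun k => x N k 0) a * L / N)) atTop (𝓝 0) := by
    rw [Metric.tendsto_nhds]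
    intro ε hε
    filter_upwards [hx t ht ε hε] with N hN
    rw [Real.dist_0_eq_abs]
    exact hN _
  simpa [Function.comp_def] using h3.add h2

/-- The limiting distribution function in terms of the inverse `Z` of the motion. -/
theorem F_eqOn (hL : 0 < L) (hm : 0 < m) {t : ℝ} {h h' Z : ℝ → ℝ}
    (hZ : IsLiftInverse L m h h' Z)
    (hx : ∀ ε > 0, ∀ᶠ N : ℕ in atTop, ∀ k : ℤ, |x N k t - h (k * L / N)| < ε) :
    EqOn (F hL x t) (fun y => (Z y - Z 0) / L) (Ico 0 L) := fun _ hy =>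
  (empirical_tendsto hL hm hZ hx hy).limUnder_eq

theorem F_hasDerivWithinAt (hL : 0 < L) (hm : 0 < m) {t : ℝ} {h h' Z : ℝ → ℝ}
    (hZ : IsLiftInverse L m h h' Z)
    (hx : ∀ ε > 0, ∀ᶠ N : ℕ in atTop, ∀ k : ℤ, |x N k t - h (k * L / N)| < ε)
    {y : ℝ} (hy : y ∈ Ico 0 L) :
    HasDerivWithinAt (F hL x t) ((h' (Z y))⁻¹ / L) (Ico 0 L) y :=
  (((hZ.hasDerivAt y).sub_const (Z 0)).div_const L).hasDerivWithinAt.congr (F_eqOn hL hm hZ hx)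
    (F_eqOn hL hm hZ hx hy)

theorem rho_eq (hL : 0 < L) (hm : 0 < m) {t : ℝ} {h h' Z : ℝ → ℝ}
    (hZ : IsLiftInverse L m h h' Z)
    (hx : ∀ ε > 0, ∀ᶠ N : ℕ in atTop, ∀ k : ℤ, |x N k t - h (k * L / N)| < ε)
    {y : ℝ} (hy : y ∈ Ico 0 L) : rho hL x t y = (h' (Z y))⁻¹ / L :=
  (F_hasDerivWithinAt hL hm hZ hx hy).derivWithin (uniqueDiffOn_Ico 0 L y hy)

/-- Reduction modulo L shifts the label by a multiple of L, which h' does not see; the factor L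
cancels the 1/L in ρ. -/
theorem rhoHat_eq (hL : 0 < L) (hm : 0 < m) {t : ℝ} {h h' Z : ℝ → ℝ}
    (hZ : IsLiftInverse L m h h' Z) (hh' : Function.Periodic h' L)
    (hx : ∀ ε > 0, ∀ᶠ N : ℕ in atTop, ∀ k : ℤ, |x N k t - h (k * L / N)| < ε)
    {z : ℝ} (hG : G X x t z = h z) : rhoHat hL X x t z = (h' z)⁻¹ := by
  unfold rhoHat
  rw [rho_eq hL hm hZ hx (toIcoMod_mem_Ico' hL _), hG]
  have h1 : toIcoMod hL 0 (h z) = h z + (-toIcoDiv hL 0 (h z) : ℤ) * L := by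
    have := self_sub_toIcoDiv_zsmul hL 0 (h z)
    rw [zsmul_eq_mul] at this
    rw [← this]
    push_cast
    ring
  rw [h1, hZ.add_zsmul, hZ.left_inv, hh'.int_mul]
  field_simp

end Continuum

end StringFlow

/-! ### The equations in Lagrangian coordinates -/

theorem mainTheorem6
    (L ω₀ α : ℝ) (hL : 0 < L) (hω₀ : 0 < ω₀) (hα : 0 ≤ α)
    (f : ℝ → ℝ) (hf : ContDiff ℝ 2 f)
    (X V : ℝ → ℝ) (hXV : StringFlow.IsProfile L X V)
    (C₁ C₂ : ℝ) (hC₁ : 0 < C₁) (hC₂ : 0 < C₂)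
    (δ : ℝ) (hδ₀ : 0 < δ) (hδ₁ : δ < 1)
    (hγ : StringFlow.gammaConst L ω₀ α X V C₁ C₂ < δ)
    (v : ℝ) (x w : ℕ → ℤ → ℝ → ℝ)
    (hdyn : ∀ᶠ N : ℕ in atTop,
      StringFlow.IsChainTrajectory L (ω₀ * N) α f N (x N) (w N))
    (hinit : ∀ᶠ N : ℕ in atTop,
      StringFlow.IsAlmostSmooth L X V C₁ C₂ N (fun k => x N k 0) (fun k => w N k 0))
    (hv : ∀ᶠ N : ℕ in atTop, w N 0 0 = v) :
    -- the limits that define the continuum exist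
    (∀ t : ℝ, 0 ≤ t → ∀ a : ℝ,
      Tendsto (fun N : ℕ => StringFlow.tracer x N t a) atTop (𝓝 (StringFlow.Y x t a))) ∧
    (∀ t : ℝ, 0 ≤ t → ∀ y ∈ Ico 0 L,
      Tendsto (fun N : ℕ => StringFlow.empiricalF hL x N t y) atTop
        (𝓝 (StringFlow.F hL x t y))) ∧
    -- the density and the velocity exist, and the density does not vanish
    (∀ t : ℝ, 0 ≤ t → ∀ y ∈ Ico 0 L,
      DifferentiableWithinAt ℝ (StringFlow.F hL x t) (Ico 0 L) y ∧
      0 < StringFlow.rho hL x t y) ∧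
    (∀ t : ℝ, 0 < t → ∀ z : ℝ, DifferentiableAt ℝ (fun s => StringFlow.G X x s z) t) ∧
    -- the equations in Lagrangian coordinates
    (∀ t : ℝ, 0 < t → ∀ z ∈ Ico 0 L,
      DifferentiableAt ℝ (fun s => 1 / StringFlow.rhoHat hL X x s z) t ∧
      DifferentiableAt ℝ (fun ζ => StringFlow.uHat X x t ζ) z ∧
      deriv (fun s => 1 / StringFlow.rhoHat hL X x s z) t
        - deriv (fun ζ => StringFlow.uHat X x t ζ) z = 0) ∧
    (∀ C : ℝ, ∀ t : ℝ, 0 < t → ∀ z ∈ Ico 0 L,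
      DifferentiableAt ℝ (fun s => StringFlow.uHat X x s z) t ∧
      DifferentiableAt ℝ (fun ζ => StringFlow.pHat hL (ω₀ * L) C X x t ζ) z ∧
      DifferentiableAt ℝ (fun ζ => (ω₀ * L) ^ 2 / StringFlow.rhoHat hL X x t ζ) z ∧
      deriv (fun s => StringFlow.uHat X x s z) t + α * StringFlow.uHat X x t z - f t
        = -deriv (fun ζ => StringFlow.pHat hL (ω₀ * L) C X x t ζ) z ∧
      -deriv (fun ζ => StringFlow.pHat hL (ω₀ * L) C X x t ζ) z
        = deriv (fun ζ => (ω₀ * L) ^ 2 / StringFlow.rhoHat hL X x t ζ) z) := by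
  obtain ⟨g, g_t, g_z, g_tt, g_tz, g_zz, hg, hg0, hgt0, m, hm, hgz⟩ :=
    StringFlow.exists_profile_motion hL hω₀ hα hf.continuous hXV hC₁ hC₂ (hγ.trans hδ₁) v
  have hneg : ∀ t : ℝ, 0 ≤ t → -1 < t := fun t ht => by linarith
  have hx : ∀ t, 0 ≤ t → ∀ ε > 0, ∀ᶠ N : ℕ in atTop, ∀ k : ℤ,
      |x N k t - g t (k * L / N)| < ε := fun t ht ε hε =>
    StringFlow.chain_tendstoUniformly hL hα hXV hC₁ hC₂ hg hg0 hgt0 hdyn hinit hv ht hε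
  have hinv : ∀ t, 0 ≤ t → ∃ Z, StringFlow.IsLiftInverse L m (g t) (g_z t) Z := fun t ht =>
    StringFlow.exists_isLiftInverse hm (fun z => hg.deriv_z t z (hneg t ht))
      (fun z => hg.add_period t z (hneg t ht)) (fun z => hgz t z ht)
  obtain ⟨Z₀, hZ₀⟩ := hinv 0 le_rfl
  have hcont : ∀ t, 0 ≤ t → Continuous (g t) := fun t ht =>
    continuous_iff_continuousAt.2 fun z => (hg.deriv_z t z (hneg t ht)).continuousAt
  have hY : ∀ t, 0 ≤ t → ∀ a, Tendsto (fun N : ℕ => StringFlow.tracer x N t a) atTop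
      (𝓝 (g t (Z₀ a))) := fun t ht a =>
    StringFlow.tracer_tendsto hL hm hx hZ₀ ht (hcont t ht) a
  -- The starting point of label z is g 0 z, so Z₀ returns z.
  have hG : ∀ t, 0 ≤ t → ∀ z, StringFlow.G X x t z = g t z := fun t ht z => by
    rw [StringFlow.G, StringFlow.Y, (hY t ht _).limUnder_eq, ← hg0, hZ₀.left_inv]
  have hrho : ∀ t, 0 ≤ t → ∀ z, StringFlow.rhoHat hL X x t z = (g_z t z)⁻¹ := fun t ht z => by
    obtain ⟨Z, hZ⟩ := hinv t ht
    exact StringFlow.rhoHat_eq hL hm hZ (hg.deriv_z_periodic (hneg t ht)) (hx t ht) (hG t ht z)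
  -- G is identified with g only for s ≥ 0, so the two-sided time derivative is taken at t > 0.
  have hGd : ∀ t, 0 < t → ∀ z, HasDerivAt (fun s => StringFlow.G X x s z) (g_t t z) t :=
    fun t ht z => (hg.deriv_t t z (hneg t ht.le)).congr_of_eventuallyEq <| by
      filter_upwards [Ioi_mem_nhds ht] with s hs using hG s (le_of_lt hs) z
  have hu : ∀ t, 0 < t → ∀ z, StringFlow.uHat X x t z = g_t t z := fun t ht z => (hGd t ht z).deriv
  have hrt : ∀ t, 0 < t → ∀ z,
      HasDerivAt (fun s => 1 / StringFlow.rhoHat hL X x s z) (g_tz t z) t := fun t ht z =>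
    (hg.deriv_zt t z (hneg t ht.le)).congr_of_eventuallyEq <| by
      filter_upwards [Ioi_mem_nhds ht] with s hs
      rw [hrho s (le_of_lt hs), one_div, inv_inv]
  have huz : ∀ t, 0 < t → ∀ z, HasDerivAt (fun ζ => StringFlow.uHat X x t ζ) (g_tz t z) z :=
    fun t ht z => (hg.deriv_tz t z (hneg t ht.le)).congr_of_eventuallyEq <|
      Eventually.of_forall fun ζ => hu t ht ζ
  have hut : ∀ t, 0 < t → ∀ z, HasDerivAt (fun s => StringFlow.uHat X x s z) (g_tt t z) t :=
    fun t ht z => (hg.deriv_tt t z (hneg t ht.le)).congr_of_eventuallyEq <| by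
      filter_upwards [Ioi_mem_nhds ht] with s hs using hu s hs z
  have hq : ∀ t, 0 < t → ∀ z, HasDerivAt (fun ζ => (ω₀ * L) ^ 2 / StringFlow.rhoHat hL X x t ζ)
      ((ω₀ * L) ^ 2 * g_zz t z) z := fun t ht z =>
    ((hg.deriv_zz t z (hneg t ht.le)).const_mul ((ω₀ * L) ^ 2)).congr_of_eventuallyEq <|
      Eventually.of_forall fun ζ => by simp only [hrho t ht.le ζ, div_inv_eq_mul]
  have hp : ∀ C t, 0 < t → ∀ z, HasDerivAt (fun ζ => StringFlow.pHat hL (ω₀ * L) C X x t ζ)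
      (-((ω₀ * L) ^ 2 * g_zz t z)) z := fun C t ht z =>
    ((hq t ht z).neg.add_const C).congr_of_eventuallyEq <|
      Eventually.of_forall fun ζ => by simp [StringFlow.pHat, neg_div]
  refine ⟨fun t ht a => ?_, fun t ht y hy => ?_, fun t ht y hy => ?_,
    fun t ht z => (hGd t ht z).differentiableAt, fun t ht z _ => ?_, fun C t ht z _ => ?_⟩
  · exact tendsto_nhds_limUnder ⟨_, hY t ht a⟩
  · obtain ⟨Z, hZ⟩ := hinv t ht
    exact tendsto_nhds_limUnder ⟨_, StringFlow.empirical_tendsto hL hm hZ (hx t ht) hy⟩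
  · obtain ⟨Z, hZ⟩ := hinv t ht
    refine ⟨(StringFlow.F_hasDerivWithinAt hL hm hZ (hx t ht) hy).differentiableWithinAt, ?_⟩
    rw [StringFlow.rho_eq hL hm hZ (hx t ht) hy]
    have := hm.trans_le (hgz t (Z y) ht)
    positivity
  · refine ⟨(hrt t ht z).differentiableAt, (huz t ht z).differentiableAt, ?_⟩
    rw [(hrt t ht z).deriv, (huz t ht z).deriv, sub_self]
  · refine ⟨(hut t ht z).differentiableAt, (hp C t ht z).differentiableAt,
      (hq t ht z).differentiableAt, ?_, ?_⟩
    · rw [(hut t ht z).deriv, (hp C t ht z).deriv, hu t ht, hg.eqn t z (hneg t ht.le)]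
      ring
    · rw [(hp C t ht z).deriv, (hq t ht z).deriv, neg_neg]
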